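/- Let $\mathcal V$ be a real Banach space with $\dim\mathcal V\ge 2$ (possibly infinite), let $T>0$, and fix a norm on the algebraic tensor product $\mathcal V\otimes\mathcal V$ with $\|v\otimes w\|\le\|v\|\,\|w\|$ for all $v,w\in\mathcal V$. Write $[v,w]=v\otimes w-w\otimes v$ and let $[\mathcal V,\mathcal V]$ be the closed linear span of all $[v,w]$ in the completion of $\mathcal V\otimes\mathcal V$. Let $\triangle=\{(s,t):0\le s\le t\le T\}$. For $p>0$ and a function $\alpha$ on $\triangle$ with values in a normed space put $\|\alpha\|_{p\text{-var}}=\big(\sup_D\sum_j\|\alpha(t_j,t_{j+1})\|^p\big)^{1/p}\in[0,\infty]$, the supremum being over all finite partitions $D=\{0=t_0<\dots<t_n=T\}$, and let $\omega_p(\alpha,\delta)$ be the same quantity with the supremum restricted to partitions of mesh at most $\delta$. For a path $\gamma$ on $[0,T]$ the quantities $\|\gamma\|_{p\text{-var}}$ and $\omega_p(\gamma,\delta)$ are those of $(s,t)\mapsto\gamma(t)-\gamma(s)$ (so $\|\cdot\|_{p\text{-var}}$ vanishes on constant paths). Let $C^{1\text{-var}}([0,T],\mathcal V)$ be the set of continuous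 paths $\gamma:[0,T]\to\mathcal V$ with $\|\gamma\|_{1\text{-var}}<\infty$, let $C^{0,2\text{-var}}([0,T],\mathcal V)$ be the set of continuous paths with $\lim_{\delta\to0}\omega_2(\gamma,\delta)=0$, and let $C^{0,1\text{-var}}(\triangle,[\mathcal V,\mathcal V])$ be the set of continuous $\alpha:\triangle\to[\mathcal V,\mathcal V]$ with $\alpha(t,t)=0$ for all $t$ and $\lim_{\delta\to0}\omega_1(\alpha,\delta)=0$. For $\gamma\in C^{1\text{-var}}([0,T],\mathcal V)$ the area of $\gamma$ is $$A(\gamma)(s,t)=\tfrac12\iint_{s<u_1<u_2<t}[d\gamma(u_1),d\gamma(u_2)]=\tfrac12\int_s^t[\gamma(u)-\gamma(s),d\gamma(u)],\qquad (s,t)\in\triangle,$$ as a Riemann--Stieltjes integral. Let $\mathcal G_2(\mathcal V)$ be the set of all $\gamma\in C^{0,2\text{-var}}([0,T],\mathcal V)$ that can be enhanced into a geometric $2$-rough path, i.e. for which there are $\alpha\in C^{0,1\text{-var}}(\triangle,[\mathcal V,\mathcal V])$ and $\gamma_n\in C^{1\text{-var}}([0,T],\mathcal V)$, $n\in\mathbb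 N$, with $$\lim_{n\to\infty}\big(\|\gamma-\gamma_n\|_{2\text{-var}}^2+\|\alpha-A(\gamma_n)\|_{1\text{-var}}\big)^{1/2}=0 .$$ Then both $\mathcal G_2(\mathcal V)$ and its complement $C^{0,2\text{-var}}([0,T],\mathcal V)\setminus\mathcal G_2(\mathcal V)$ are dense in $C^{0,2\text{-var}}([0,T],\mathcal V)$ under the $2$-variation norm: for every $\gamma\in C^{0,2\text{-var}}([0,T],\mathcal V)$ and every $\varepsilon>0$ there are $\eta\in\mathcal G_2(\mathcal V)$ and $\eta'\in C^{0,2\text{-var}}([0,T],\mathcal V)\setminus\mathcal G_2(\mathcal V)$ with $\|\gamma-\eta\|_{2\text{-var}}<\varepsilon$ and $\|\gamma-\eta'\|_{2\text{-var}}<\varepsilon$. -/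

import Mathlib

open Set Filter Topology MeasureTheory
open scoped NNReal ENNReal TensorProduct

noncomputable section

namespace RoughArea

universe u v w

/-! ### Partitions, variation -/

/-- The time interval `[0, T]`. -/
abbrev Time (T : ℝ) : Type := Set.Icc (0 : ℝ) T

/-- The triangle of all `(s, t)` with `0 ≤ s ≤ t ≤ T`. -/
abbrev Triangle (T : ℝ) : Type := {p : Time T × Time T // p.1 ≤ p.2}

/-- A finite partition `a = t_0 < t_1 < ... < t_n = b` of `[a, b]`, with points in `[0, T]`. -/
structure Partition (T a b : ℝ) where
  n : ℕ
  pts : Fin (n + 1) → Time T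
  strictMono : StrictMono pts
  first : (pts 0 : ℝ) = a
  last : (pts (Fin.last n) : ℝ) = b

namespace Partition

variable {T a b : ℝ}

/-- The `j`-th interval `(t_j, t_{j+1})` of a partition, as a point of the triangle. -/
def seg (D : Partition T a b) (j : Fin D.n) : Triangle T :=
  ⟨(D.pts j.castSucc, D.pts j.succ), D.strictMono.monotone (Fin.castSucc_lt_succ).le⟩

/-- The mesh `|D| = max_j |t_{j+1} - t_j|`. -/
def mesh (D : Partition T a b) : ℝ≥0 :=
  Finset.univ.sup fun j : Fin D.n => nndist (D.seg j).1.1 (D.seg j).1.2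

end Partition

variable {T : ℝ}

/-- The sum `∑_j ‖α(t_j, t_{j+1})‖ ^ p` over a partition of `[0, T]`. -/
def varSum {E : Type u} [NormedAddCommGroup E] (p : ℝ) (α : Triangle T → E)
    (D : Partition T 0 T) : ℝ≥0∞ :=
  ∑ j : Fin D.n, ‖α (D.seg j)‖ₑ ^ p

/-- The `p`-variation (possibly infinite) of a function on the triangle. -/
def pVar {E : Type u} [NormedAddCommGroup E] (p : ℝ) (α : Triangle T → E) : ℝ≥0∞ :=
  (⨆ D : Partition T 0 T, varSum p α D) ^ (1 / p)

/-- `ω_p(α, δ)`: the `p`-variation restricted to partitions of mesh at most `δ`. -/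
def pVarMesh {E : Type u} [NormedAddCommGroup E] (p : ℝ) (α : Triangle T → E) (δ : ℝ≥0) :
    ℝ≥0∞ :=
  (⨆ D : Partition T 0 T, ⨆ _ : D.mesh ≤ δ, varSum p α D) ^ (1 / p)

/-- `α` is of vanishing `p`-variation: `ω_p(α, δ) → 0` as `δ → 0+`. -/
def VanishingPVar {E : Type u} [NormedAddCommGroup E] (p : ℝ) (α : Triangle T → E) : Prop :=
  Tendsto (fun δ : ℝ≥0 => pVarMesh p α δ) (𝓝[>] 0) (𝓝 0)

/-- The increments `(s, t) ↦ γ(t) - γ(s)` of a path. -/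
def incr {E : Type u} [NormedAddCommGroup E] (γ : C(Time T, E)) : Triangle T → E :=
  fun p => γ p.1.2 - γ p.1.1

/-- `C^{p-var}([0,T], E)`. -/
def pVarPaths (T : ℝ) (E : Type u) [NormedAddCommGroup E] (p : ℝ) : Set C(Time T, E) :=
  {γ | pVar p (incr γ) < ∞}

/-- `C^{0,p-var}([0,T], E)`. -/
def vanishingPaths (T : ℝ) (E : Type u) [NormedAddCommGroup E] (p : ℝ) : Set C(Time T, E) :=
  {γ | VanishingPVar p (incr γ)}

/-- `C^{0,p-var}` on the triangle: continuous functions, zero on the diagonal, of vanishing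
`p`-variation. -/
def vanishingTriangle (T : ℝ) (E : Type u) [NormedAddCommGroup E] (p : ℝ) :
    Set C(Triangle T, E) :=
  {α | (∀ t : Time T, α ⟨(t, t), le_rfl⟩ = 0) ∧ VanishingPVar p α}

/-- `S` is dense in `A` under the `p`-variation norm. -/
def DenseInPVar {E : Type u} [NormedAddCommGroup E] (p : ℝ) (S A : Set C(Time T, E)) : Prop :=
  S ⊆ A ∧ ∀ γ ∈ A, ∀ ε : ℝ, 0 < ε → ∃ η ∈ S, pVar p (incr (γ - η)) < ENNReal.ofReal ε

/-! ### The completed tensor product and the space `[V, V]` -/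

/-- A norm on the algebraic tensor product `V ⊗ V` with `‖v ⊗ w‖ ≤ ‖v‖ ‖w‖`. -/
structure TensorNorm (V : Type u) [NormedAddCommGroup V] [NormedSpace ℝ V] where
  toSeminorm : Seminorm ℝ (V ⊗[ℝ] V)
  eq_zero : ∀ x, toSeminorm x = 0 → x = 0
  tmul_le : ∀ v w : V, toSeminorm (v ⊗ₜ[ℝ] w) ≤ ‖v‖ * ‖w‖

section Tensor

variable {V : Type u} [NormedAddCommGroup V] [NormedSpace ℝ V]

/-- The algebraic tensor product `V ⊗ V`, to be normed by `N`. -/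
def AlgTensor (_N : TensorNorm V) : Type u := V ⊗[ℝ] V

instance (N : TensorNorm V) : AddCommGroup (AlgTensor N) :=
  inferInstanceAs (AddCommGroup (V ⊗[ℝ] V))

instance (N : TensorNorm V) : Module ℝ (AlgTensor N) :=
  inferInstanceAs (Module ℝ (V ⊗[ℝ] V))

instance (N : TensorNorm V) : Norm (AlgTensor N) := ⟨fun x => N.toSeminorm x⟩

theorem AlgTensor.core (N : TensorNorm V) : NormedSpace.Core ℝ (AlgTensor N) where
  norm_nonneg x := apply_nonneg N.toSeminorm x
  norm_smul c x := map_smul_eq_mul N.toSeminorm c x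
  norm_triangle x y := map_add_le_add N.toSeminorm x y
  norm_eq_zero_iff x := ⟨N.eq_zero x, fun h => by
    subst h; exact map_zero N.toSeminorm⟩

instance (N : TensorNorm V) : NormedAddCommGroup (AlgTensor N) :=
  NormedAddCommGroup.ofCore (AlgTensor.core N)

instance (N : TensorNorm V) : NormedSpace ℝ (AlgTensor N) :=
  NormedSpace.ofCore (AlgTensor.core N)

/-- The Banach space `V ⊗ V`: the completion of the algebraic tensor product. -/
abbrev Tensor (N : TensorNorm V) : Type u := UniformSpace.Completion (AlgTensor N)

/-- The elementary tensor `v ⊗ w` in the completed tensor product. -/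
def tensor (N : TensorNorm V) (v w : V) : Tensor N :=
  ((show AlgTensor N from v ⊗ₜ[ℝ] w : AlgTensor N) : Tensor N)

/-- The Banach space `[V, V]`: the closed linear span of all `v ⊗ w - w ⊗ v`. -/
def commutatorSpace (N : TensorNorm V) : Submodule ℝ (Tensor N) :=
  (Submodule.span ℝ
    (Set.range fun p : V × V => tensor N p.1 p.2 - tensor N p.2 p.1)).topologicalClosure

/-- `[v, w] = v ⊗ w - w ⊗ v`, as an element of `[V, V]`. -/
def bracket (N : TensorNorm V) (v w : V) : commutatorSpace N :=
  ⟨tensor N v w - tensor N w v,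
    Submodule.le_topologicalClosure _ (Submodule.subset_span ⟨(v, w), rfl⟩)⟩

end Tensor

/-! ### Riemann-Stieltjes integrals and area -/

/-- `I` is the Riemann-Stieltjes integral `∫_s^t B(f(r), dg(r))`: the sums
`∑_j B(f(ξ_j), g(t_{j+1}) - g(t_j))` converge to `I` as the mesh of the partition of `[s, t]`
tends to `0`, uniformly in the choice of `ξ_j ∈ [t_j, t_{j+1}]`. -/
def HasStieltjesIntegral {E : Type u} {F : Type v} {W : Type w} [NormedAddCommGroup F]
    [NormedAddCommGroup W] (B : E → F → W) (f : Time T → E) (g : Time T → F)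
    (s t : Time T) (I : W) : Prop :=
  ∀ ε : ℝ, 0 < ε → ∃ δ : ℝ≥0, 0 < δ ∧ ∀ D : Partition T s t, D.mesh ≤ δ →
    ∀ ξ : Fin D.n → Time T, (∀ j, ξ j ∈ Set.Icc (D.pts j.castSucc) (D.pts j.succ)) →
      ‖(∑ j : Fin D.n, B (f (ξ j)) (g (D.pts j.succ) - g (D.pts j.castSucc))) - I‖ < ε

section Rough

variable {V : Type u} [NormedAddCommGroup V] [NormedSpace ℝ V]

/-- `a` is the area `A(γ)`, i.e. for all `s ≤ t`, `a(s,t)` is the iterated integral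
`(1/2) ∬_{s<r₁<r₂<t} [dγ(r₁), dγ(r₂)] = (1/2) ∫_s^t [γ(r) - γ(s), dγ(r)]`; the inner integral
`∫_s^r dγ` is `γ(r) - γ(s)`. For a continuous path of bounded variation the integral exists,
and it is unique. -/
def IsArea (N : TensorNorm V) (γ : C(Time T, V)) (a : Triangle T → commutatorSpace N) : Prop :=
  ∀ p : Triangle T, ∃ I : commutatorSpace N,
    HasStieltjesIntegral (bracket N) (fun r => γ r - γ p.1.1) γ p.1.1 p.1.2 I ∧
      a p = (1 / 2 : ℝ) • I

/-- The `2`-rough norm `(‖γ‖_{2-var}² + ‖α‖_{1-var})^{1/2}` of a pair `(γ, α)`. -/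
def roughNorm (N : TensorNorm V) (γ : C(Time T, V)) (α : Triangle T → commutatorSpace N) :
    ℝ≥0∞ :=
  (pVar 2 (incr γ) ^ 2 + pVar 1 α) ^ (1 / 2 : ℝ)

/-- `(γ, α)` is a geometric `2`-rough path: the limit in `2`-rough norm of `(γ_k, A(γ_k))` for a
sequence of continuous paths `γ_k` of bounded variation. -/
def IsGeometricRoughPath (N : TensorNorm V) (γ : C(Time T, V))
    (α : C(Triangle T, commutatorSpace N)) : Prop :=
  (∀ t : Time T, α ⟨(t, t), le_rfl⟩ = 0) ∧
    ∃ (γs : ℕ → C(Time T, V)) (as : ℕ → Triangle T → commutatorSpace N),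
      (∀ k, γs k ∈ pVarPaths T V 1 ∧ IsArea N (γs k) (as k)) ∧
        Tendsto (fun k => roughNorm N (γ - γs k) (fun p => α p - as k p)) atTop (𝓝 0)

/-- `G₂(V)`: the paths of vanishing `2`-variation which can be enhanced into a geometric
`2`-rough path. -/
def G2 (T : ℝ) (N : TensorNorm V) : Set C(Time T, V) :=
  {γ | γ ∈ vanishingPaths T V 2 ∧
    ∃ α ∈ vanishingTriangle T (commutatorSpace N) 1, IsGeometricRoughPath N γ α}

end Rough

end RoughArea

end

/-!
A path in `G₂` has bounded polygonal areas. If `γ_k → γ` in `2`-variation with `A(γ_k) → α` in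
`1`-variation, then Chen's relation expresses the area of the polygon inscribed in `γ_k` along a
partition `D` as `A(γ_k)(0, T) - ∑ A(γ_k)(t_j, t_{j+1})`, which for `D` of small mesh is bounded
uniformly in `k` and `D`; letting `k → ∞` bounds the polygonal areas of `γ` itself
(`exists_norm_polygonArea_le`).

Polygonal areas are nevertheless not controlled by vanishing `2`-variation. The lacunary loop
`∑ 2^{-k} (k+1)^{-1/2} exp(2πi 4^k t)` is `o(√|t-s|)`, hence of vanishing `2`-variation
(`exists_norm_loop_sub_le`), while by orthogonality of the modes the polygon with `4^m` vertices
inscribed in it has area at least a multiple of `∑_{k<m} 1/(k+1)` (`sum_inv_le_polygon_loop`).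
Placed in a plane spanned by independent `v`, `w`, where `[v, w] ≠ 0`, this gives a path `ζ` with
unbounded polygonal areas. Since polygonal area is a quadratic form, the parallelogram identity
shows that `γ`, `γ + κζ`, `γ - κζ` cannot all lie in `G₂` for `κ ≠ 0`, so that the complement of
`G₂` is dense (`denseInPVar_compl_G2`).

For the density of `G₂`, the moving averages `h⁻¹ ∫_t^{t+h} γ` are `C¹`, so that they are enhanced by
their own area (`mem_G2_of_hasDerivAt`). They converge to `γ` in `2`-variation since the translates
of `γ` do: increments over short intervals are small by vanishing `2`-variation, and there are few
long ones (`exists_sum_translate_le`). The bookkeeping with partitions is done with the inductive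
predicate `FineChain`, which is closed under concatenation.
-/

/-! ### Partitions and variation -/

namespace RoughArea

variable {T : ℝ}

/-- `FineChain F δ a b S`: there is a chain `a = t_0 < ⋯ < t_n = b` with steps at most `δ` along
which the sum of the `F t_j t_{j+1}` is `S`. This is the inductive form of a partition of `[a, b]`
of mesh at most `δ`, convenient for concatenation. -/
inductive FineChain {M : Type*} [AddCommMonoid M] (F : Time T → Time T → M) (δ : ℝ≥0)
    (a : Time T) : Time T → M → Prop
  | nil : FineChain F δ a a 0
  | snoc {b c : Time T} {S : M} : FineChain F δ a b S → b < c → nndist b c ≤ δ →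
      FineChain F δ a c (S + F b c)

namespace FineChain

variable {M : Type*} [AddCommMonoid M] {F : Time T → Time T → M} {δ : ℝ≥0} {a b c : Time T}
  {S S' : M}

theorem trans (h : FineChain F δ a b S) (h' : FineChain F δ b c S') :
    FineChain F δ a c (S + S') := by
  induction h' with
  | nil => simpa using h
  | snoc _ hlt hd ih => rw [← add_assoc]; exact ih.snoc hlt hd

theorem exists_partition (h : FineChain F δ a b S) :
    ∃ D : Partition T a b, D.mesh ≤ δ ∧
      ∑ j : Fin D.n, F (D.pts j.castSucc) (D.pts j.succ) = S := by
  induction h with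
  | nil =>
    refine ⟨⟨0, fun _ => a, ?_, rfl, rfl⟩, ?_, ?_⟩
    · exact Subsingleton.strictMono (α := Fin 1) _
    · simp [Partition.mesh]
    · simp
  | @snoc b c S _ hlt hd ih =>
    obtain ⟨D, hm, hS⟩ := ih
    have hb : D.pts (Fin.last D.n) = b := Subtype.ext D.last
    refine ⟨⟨D.n + 1, Fin.snoc D.pts c, ?_, ?_, ?_⟩, ?_, ?_⟩
    · rw [Fin.strictMono_iff_lt_succ]
      intro i
      refine Fin.lastCases ?_ (fun i => ?_) i
      · rw [Fin.succ_last, Fin.snoc_last, Fin.snoc_castSucc, hb]; exact hlt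
      · rw [Fin.succ_castSucc, Fin.snoc_castSucc, Fin.snoc_castSucc]
        exact D.strictMono Fin.castSucc_lt_succ
    · rw [← Fin.castSucc_zero, Fin.snoc_castSucc]; exact D.first
    · rw [Fin.snoc_last]
    · refine Finset.sup_le fun i _ => ?_
      simp only [Partition.seg]
      refine Fin.lastCases ?_ (fun i => ?_) i
      · rw [Fin.succ_last, Fin.snoc_last, Fin.snoc_castSucc, hb]; exact hd
      · rw [Fin.succ_castSucc, Fin.snoc_castSucc, Fin.snoc_castSucc]
        exact (Finset.le_sup (f := fun j : Fin D.n => nndist (D.seg j).1.1 (D.seg j).1.2)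
          (Finset.mem_univ i)).trans hm
    · rw [Fin.sum_univ_castSucc]
      simp only [Fin.succ_last, Fin.snoc_last, Fin.succ_castSucc]
      simp only [Fin.snoc_castSucc]
      rw [hS, hb]

end FineChain

theorem nndist_le_iff {a b : Time T} (h : a ≤ b) (δ : ℝ≥0) :
    nndist a b ≤ δ ↔ (b : ℝ) - a ≤ δ := by
  rw [← NNReal.coe_le_coe, coe_nndist, Subtype.dist_eq, Real.dist_eq, abs_sub_comm,
    abs_of_nonneg (sub_nonneg.2 (Subtype.coe_le_coe.2 h))]

/-- Any interval can be subdivided into steps of length at most `δ`. -/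
theorem FineChain.exists_of_le {M : Type*} [AddCommMonoid M] (F : Time T → Time T → M) {δ : ℝ≥0}
    (hδ : 0 < δ) {a b : Time T} (hab : a ≤ b) : ∃ S, FineChain F δ a b S := by
  obtain ⟨N, hN⟩ := exists_nat_ge (((b : ℝ) - a) / δ)
  have hδ' : (0 : ℝ) < δ := hδ
  rw [div_le_iff₀ hδ'] at hN
  induction N generalizing b with
  | zero =>
    have : b = a := le_antisymm (by simpa using hN) hab
    exact ⟨0, this ▸ .nil⟩
  | succ N ih =>
    by_cases h : (b : ℝ) - a ≤ δ
    · rcases hab.eq_or_lt with rfl | hlt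
      · exact ⟨0, .nil⟩
      · exact ⟨_, FineChain.nil.snoc hlt ((nndist_le_iff hab δ).2 h)⟩
    · push Not at h
      have hc : (b : ℝ) - δ ∈ Set.Icc (0 : ℝ) T := ⟨by linarith [a.2.1], by linarith [b.2.2]⟩
      have hcb : (⟨_, hc⟩ : Time T) < b := Subtype.coe_lt_coe.1 (by simpa using hδ)
      obtain ⟨S, hS⟩ := ih (b := ⟨_, hc⟩) (Subtype.coe_le_coe.1 (by simp; linarith))
        (by push_cast at hN; simp; linarith)
      exact ⟨_, hS.snoc hcb ((nndist_le_iff hcb.le δ).2 (by simp))⟩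

theorem FineChain.nonneg {F : Time T → Time T → ℝ} (hF : ∀ s t, 0 ≤ F s t) {δ : ℝ≥0}
    {a b : Time T} {S : ℝ} (h : FineChain F δ a b S) : 0 ≤ S := by
  induction h with
  | nil => rfl
  | snoc _ _ _ ih => exact add_nonneg ih (hF _ _)

/-- The intervals of length at most `δ` of a monotone sequence are among the steps of a chain of
mesh at most `δ`. -/
theorem FineChain.exists_sum_short_le {F : Time T → Time T → ℝ} (hF : ∀ s t, 0 ≤ F s t)
    (hF0 : ∀ t, F t t = 0) {δ : ℝ≥0} (hδ : 0 < δ) {x : ℕ → Time T} (hx : Monotone x) (n : ℕ) :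
    ∃ S, FineChain F δ (x 0) (x n) S ∧
      ∑ k ∈ Finset.range n,
        (if (x (k + 1) : ℝ) - x k ≤ δ then F (x k) (x (k + 1)) else 0) ≤ S := by
  induction n with
  | zero => exact ⟨0, .nil, by simp⟩
  | succ n ih =>
    obtain ⟨S, hS, hle⟩ := ih
    have hn := hx n.le_succ
    rw [Finset.sum_range_succ]
    by_cases h : (x (n + 1) : ℝ) - x n ≤ δ
    · rw [if_pos h]
      rcases hn.eq_or_lt with he | hlt
      · simp only [Nat.succ_eq_add_one] at he
        refine ⟨S, he ▸ hS, ?_⟩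
        rw [← he, hF0, add_zero]; exact hle
      · exact ⟨_, hS.snoc hlt ((nndist_le_iff hn δ).2 h), by gcongr⟩
    · rw [if_neg h]
      obtain ⟨S', hS'⟩ := FineChain.exists_of_le F hδ hn
      exact ⟨_, hS.trans hS', add_le_add hle (hS'.nonneg hF)⟩

namespace Partition

/-- The points of a partition as a monotone sequence, constant from the last point on. -/
theorem exists_seq {a b : ℝ} (D : Partition T a b) :
    ∃ x : ℕ → Time T, Monotone x ∧ (x 0 : ℝ) = a ∧ (x D.n : ℝ) = b ∧
      ∀ j : Fin D.n, D.pts j.castSucc = x j ∧ D.pts j.succ = x (j + 1) := by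
  refine ⟨fun k => D.pts ⟨min k D.n, by omega⟩, fun k l hkl => ?_, ?_, ?_, fun j => ⟨?_, ?_⟩⟩
  · exact D.strictMono.monotone (Fin.mk_le_mk.2 (min_le_min_right _ hkl))
  · simpa using D.first
  · simp only [min_self]; exact D.last
  · congr 1; ext; simp [j.2.le]
  · congr 1; ext; simp only [Fin.val_succ]; omega

theorem sum_sub {a b : ℝ} (D : Partition T a b) {M : Type*} [AddCommGroup M] (φ : Time T → M)
    {s t : Time T} (hs : (s : ℝ) = a) (ht : (t : ℝ) = b) :
    ∑ j : Fin D.n, (φ (D.pts j.succ) - φ (D.pts j.castSucc)) = φ t - φ s := by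
  obtain ⟨x, -, h0, hn, hx⟩ := D.exists_seq
  rw [← Subtype.ext (h0.trans hs.symm), ← Subtype.ext (hn.trans ht.symm),
    ← Finset.sum_range_sub (fun k => φ (x k)), ← Fin.sum_univ_eq_sum_range]
  exact Finset.sum_congr rfl fun j _ => by rw [(hx j).1, (hx j).2]

theorem sum_length {a b : ℝ} (D : Partition T a b) :
    ∑ j : Fin D.n, ((D.pts j.succ : ℝ) - D.pts j.castSucc) = b - a := by
  have := D.sum_sub (fun t => (t : ℝ)) (s := D.pts 0) (t := D.pts (Fin.last _)) D.first D.last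
  rw [this, D.first, D.last]

theorem seg_le (D : Partition T 0 T) (j : Fin D.n) : D.pts j.castSucc ≤ D.pts j.succ :=
  D.strictMono.monotone Fin.castSucc_lt_succ.le

theorem length_le_mesh {a b : ℝ} (D : Partition T a b) (j : Fin D.n) :
    (D.pts j.succ : ℝ) - D.pts j.castSucc ≤ D.mesh := by
  rw [← nndist_le_iff (D.strictMono.monotone Fin.castSucc_lt_succ.le)]
  exact Finset.le_sup (f := fun j : Fin D.n => nndist (D.seg j).1.1 (D.seg j).1.2)
    (Finset.mem_univ j)

end Partition

/-- If `F` sums to at most `c` along all partitions of mesh at most `δ`, then so it does over the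
intervals of length at most `δ` of any monotone sequence. -/
theorem sum_short_le {F : Time T → Time T → ℝ} (hF : ∀ s t, 0 ≤ F s t)
    (hF0 : ∀ t, F t t = 0) {δ : ℝ≥0} (hδ : 0 < δ) {c : ℝ}
    (hc : ∀ D : Partition T 0 T, D.mesh ≤ δ →
      ∑ j : Fin D.n, F (D.pts j.castSucc) (D.pts j.succ) ≤ c)
    {x : ℕ → Time T} (hx : Monotone x) (n : ℕ) :
    ∑ k ∈ Finset.range n,
      (if (x (k + 1) : ℝ) - x k ≤ δ then F (x k) (x (k + 1)) else 0) ≤ c := by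
  have hT : 0 ≤ T := (x 0).2.1.trans (x 0).2.2
  obtain ⟨S, hS, hle⟩ := FineChain.exists_sum_short_le hF hF0 hδ hx n
  obtain ⟨S₀, h₀⟩ := FineChain.exists_of_le F hδ (a := ⟨0, le_rfl, hT⟩) (b := x 0) (x 0).2.1
  obtain ⟨S₁, h₁⟩ := FineChain.exists_of_le F hδ (a := x n) (b := ⟨T, hT, le_rfl⟩) (x n).2.2
  obtain ⟨D, hD, hsum⟩ := ((h₀.trans hS).trans h₁).exists_partition
  have := hc D hD
  rw [hsum] at this
  linarith [h₀.nonneg hF, h₁.nonneg hF]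

section Variation

variable {E : Type*} [NormedAddCommGroup E]

theorem varSum_eq_ofReal {p : ℝ} (hp : 0 < p) (α : Triangle T → E) (D : Partition T 0 T) :
    varSum p α D = ENNReal.ofReal (∑ j : Fin D.n, ‖α (D.seg j)‖ ^ p) := by
  rw [varSum, ENNReal.ofReal_sum_of_nonneg fun _ _ => by positivity]
  refine Finset.sum_congr rfl fun j _ => ?_
  rw [← ofReal_norm, ENNReal.ofReal_rpow_of_nonneg (norm_nonneg _) hp.le]

theorem pVar_le_ofReal_iff {p : ℝ} (hp : 0 < p) {α : Triangle T → E} {c : ℝ} (hc : 0 ≤ c) :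
    pVar p α ≤ ENNReal.ofReal c ↔
      ∀ D : Partition T 0 T, ∑ j : Fin D.n, ‖α (D.seg j)‖ ^ p ≤ c ^ p := by
  rw [pVar, one_div, ENNReal.rpow_inv_le_iff hp, iSup_le_iff,
    ENNReal.ofReal_rpow_of_nonneg hc hp.le]
  simp_rw [varSum_eq_ofReal hp]
  exact forall_congr' fun D => ENNReal.ofReal_le_ofReal_iff (by positivity)

theorem pVarMesh_le_ofReal_iff {p : ℝ} (hp : 0 < p) {α : Triangle T → E} {c : ℝ} (hc : 0 ≤ c)
    {δ : ℝ≥0} :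
    pVarMesh p α δ ≤ ENNReal.ofReal c ↔
      ∀ D : Partition T 0 T, D.mesh ≤ δ → ∑ j : Fin D.n, ‖α (D.seg j)‖ ^ p ≤ c ^ p := by
  rw [pVarMesh, one_div, ENNReal.rpow_inv_le_iff hp, iSup_le_iff,
    ENNReal.ofReal_rpow_of_nonneg hc hp.le]
  simp_rw [iSup_le_iff, varSum_eq_ofReal hp]
  exact forall_congr' fun D => forall_congr' fun _ =>
    ENNReal.ofReal_le_ofReal_iff (by positivity)

theorem vanishingPVar_iff {p : ℝ} (hp : 0 < p) {α : Triangle T → E} :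
    VanishingPVar p α ↔ ∀ ε : ℝ, 0 < ε → ∃ δ : ℝ≥0, 0 < δ ∧ ∀ D : Partition T 0 T, D.mesh ≤ δ →
      ∑ j : Fin D.n, ‖α (D.seg j)‖ ^ p ≤ ε := by
  rw [VanishingPVar, ENNReal.tendsto_nhds_zero]
  constructor
  · intro h ε hε
    have hε' : 0 < ε ^ (1 / p) := by positivity
    obtain ⟨δ, hδ, h0⟩ :=
      ((h (ENNReal.ofReal (ε ^ (1 / p))) (by simpa using hε')).and self_mem_nhdsWithin).exists
    refine ⟨δ, h0, fun D hD => ?_⟩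
    have := (pVarMesh_le_ofReal_iff hp hε'.le).1 hδ D hD
    rwa [one_div, Real.rpow_inv_rpow hε.le hp.ne'] at this
  · intro h ε hε
    obtain ⟨c, hc, hcε⟩ : ∃ c : ℝ, 0 < c ∧ ENNReal.ofReal c ≤ ε := by
      rcases eq_or_ne ε ∞ with rfl | hne
      · exact ⟨1, one_pos, le_top⟩
      · exact ⟨ε.toReal, ENNReal.toReal_pos hε.ne' hne, ENNReal.ofReal_toReal_le⟩
    obtain ⟨δ, hδ, hD⟩ := h (c ^ p) (by positivity)
    filter_upwards [Ioc_mem_nhdsGT hδ] with δ' hδ'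
    exact ((pVarMesh_le_ofReal_iff hp hc.le).2
      fun D hD' => hD D (hD'.trans hδ'.2)).trans hcε

/-- A two-parameter function which is `o((t - s) ^ (1 / p))`, uniformly, is of vanishing
`p`-variation. -/
theorem vanishingPVar_of_little_holder {p : ℝ} (hp : 0 < p) (hT : 0 < T) {α : Triangle T → E}
    (h : ∀ ε : ℝ, 0 < ε → ∃ δ : ℝ, 0 < δ ∧ ∀ q : Triangle T, (q.1.2 : ℝ) - q.1.1 ≤ δ →
      ‖α q‖ ^ p ≤ ε * (q.1.2 - q.1.1)) : VanishingPVar p α := by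
  rw [vanishingPVar_iff hp]
  intro ε hε
  obtain ⟨δ, hδ, h⟩ := h (ε / T) (by positivity)
  refine ⟨⟨δ, hδ.le⟩, hδ, fun D hD => ?_⟩
  calc ∑ j : Fin D.n, ‖α (D.seg j)‖ ^ p
      ≤ ∑ j : Fin D.n, ε / T * ((D.pts j.succ : ℝ) - D.pts j.castSucc) :=
        Finset.sum_le_sum fun j _ => h _ ((D.length_le_mesh j).trans hD)
    _ = ε := by rw [← Finset.mul_sum, D.sum_length]; field_simp; ring

/-- A `1 / p`-Hölder two-parameter function is of finite `p`-variation. -/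
theorem pVar_le_of_holder {p : ℝ} (hp : 0 < p) {α : Triangle T → E} {C c : ℝ}
    (h : ∀ q : Triangle T, ‖α q‖ ^ p ≤ C * (q.1.2 - q.1.1)) (hc : 0 ≤ c) (hCc : C * T ≤ c ^ p) :
    pVar p α ≤ ENNReal.ofReal c := by
  rw [pVar_le_ofReal_iff hp hc]
  intro D
  calc ∑ j : Fin D.n, ‖α (D.seg j)‖ ^ p
      ≤ ∑ j : Fin D.n, C * ((D.pts j.succ : ℝ) - D.pts j.castSucc) :=
        Finset.sum_le_sum fun j _ => h _
    _ ≤ c ^ p := by rw [← Finset.mul_sum, D.sum_length, sub_zero]; exact hCc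

theorem vanishingPaths_two_iff {γ : C(Time T, E)} :
    γ ∈ vanishingPaths T E 2 ↔ ∀ ε : ℝ, 0 < ε → ∃ δ : ℝ≥0, 0 < δ ∧ ∀ D : Partition T 0 T,
      D.mesh ≤ δ → ∑ j : Fin D.n, ‖γ (D.pts j.succ) - γ (D.pts j.castSucc)‖ ^ 2 ≤ ε := by
  rw [vanishingPaths, Set.mem_ofPred_eq, vanishingPVar_iff two_pos]
  simp only [Real.rpow_two, incr, Partition.seg]

theorem add_mem_vanishingPaths {γ η : C(Time T, E)} (hγ : γ ∈ vanishingPaths T E 2)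
    (hη : η ∈ vanishingPaths T E 2) : γ + η ∈ vanishingPaths T E 2 := by
  rw [vanishingPaths_two_iff] at *
  intro ε hε
  obtain ⟨δ₁, h₁, H₁⟩ := hγ (ε / 4) (by positivity)
  obtain ⟨δ₂, h₂, H₂⟩ := hη (ε / 4) (by positivity)
  refine ⟨min δ₁ δ₂, lt_min h₁ h₂, fun D hD => ?_⟩
  have e₁ := H₁ D (hD.trans (min_le_left _ _))
  have e₂ := H₂ D (hD.trans (min_le_right _ _))
  calc _ ≤ ∑ j : Fin D.n, (2 * ‖γ (D.pts j.succ) - γ (D.pts j.castSucc)‖ ^ 2 +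
        2 * ‖η (D.pts j.succ) - η (D.pts j.castSucc)‖ ^ 2) := by
        refine Finset.sum_le_sum fun j _ => ?_
        have := norm_add_le (γ (D.pts j.succ) - γ (D.pts j.castSucc))
          (η (D.pts j.succ) - η (D.pts j.castSucc))
        rw [ContinuousMap.add_apply, ContinuousMap.add_apply, add_sub_add_comm]
        refine (pow_le_pow_left₀ (norm_nonneg _) this 2).trans ?_
        rw [← mul_add]
        exact add_sq_le
    _ ≤ ε := by rw [Finset.sum_add_distrib, ← Finset.mul_sum, ← Finset.mul_sum]; linarith

end Variation

/-- The increments of a path are bounded by its `2`-variation. -/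
theorem norm_sub_le_pVar {E : Type*} [NormedAddCommGroup E] (γ : C(Time T, E)) {s t : Time T}
    (hst : s ≤ t) : ENNReal.ofReal ‖γ t - γ s‖ ≤ pVar 2 (incr γ) := by
  rcases hst.eq_or_lt with rfl | hlt
  · simp
  have hT : 0 ≤ T := s.2.1.trans s.2.2
  rcases eq_or_ne (pVar 2 (incr γ)) ∞ with htop | hfin
  · simp [htop]
  set c := (pVar 2 (incr γ)).toReal with hc
  have hle : pVar 2 (incr γ) ≤ ENNReal.ofReal c := (ENNReal.ofReal_toReal hfin).ge
  rw [pVar_le_ofReal_iff two_pos ENNReal.toReal_nonneg] at hle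
  rw [← ENNReal.ofReal_toReal hfin]
  refine ENNReal.ofReal_le_ofReal ?_
  have hδ : 0 < nndist s t := pos_iff_ne_zero.2 (by simpa [nndist_eq_zero] using hlt.ne)
  have hF : ∀ a b, 0 ≤ ‖γ b - γ a‖ ^ 2 := fun _ _ => by positivity
  have := sum_short_le (F := fun a b => ‖γ b - γ a‖ ^ 2) hF (fun _ => by simp) hδ
    (c := c ^ 2) (fun D _ => by simpa [incr, Partition.seg] using hle D)
    (x := fun k => if k = 0 then s else t) (by
      refine monotone_nat_of_le_succ fun k => ?_
      split_ifs <;> simp_all) 1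
  simp only [Finset.range_one, Finset.sum_singleton, if_true, zero_add, one_ne_zero,
    if_false] at this
  rw [if_pos ((nndist_le_iff hst _).1 le_rfl)] at this
  exact (pow_le_pow_iff_left₀ (norm_nonneg _) ENNReal.toReal_nonneg two_ne_zero).1 this

end RoughArea

/-! ### The bracket, Chen's relation and the obstruction to an enhancement -/

namespace RoughArea

variable {T : ℝ} {V : Type*} [NormedAddCommGroup V] [NormedSpace ℝ V] (N : TensorNorm V)

theorem norm_tensor_le (v w : V) : ‖tensor N v w‖ ≤ ‖v‖ * ‖w‖ := by
  rw [tensor, UniformSpace.Completion.norm_coe]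
  exact N.tmul_le v w

theorem tensor_add_left (v v' w : V) : tensor N (v + v') w = tensor N v w + tensor N v' w := by
  rw [tensor, tensor, tensor, ← UniformSpace.Completion.coe_add]
  exact congrArg _ (TensorProduct.add_tmul v v' w)

theorem tensor_add_right (v w w' : V) : tensor N v (w + w') = tensor N v w + tensor N v w' := by
  rw [tensor, tensor, tensor, ← UniformSpace.Completion.coe_add]
  exact congrArg _ (TensorProduct.tmul_add v w w')

theorem tensor_smul_left (c : ℝ) (v w : V) : tensor N (c • v) w = c • tensor N v w := by
  rw [tensor, tensor, ← UniformSpace.Completion.coe_smul]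
  exact congrArg _ (TensorProduct.smul_tmul' c v w)

theorem tensor_smul_right (c : ℝ) (v w : V) : tensor N v (c • w) = c • tensor N v w := by
  rw [tensor, tensor, ← UniformSpace.Completion.coe_smul]
  exact congrArg _ (TensorProduct.tmul_smul c v w)

/-- The bracket as a bounded bilinear map `V × V → [V, V]`. -/
noncomputable def bracketCLM : V →L[ℝ] V →L[ℝ] commutatorSpace N :=
  LinearMap.mkContinuous₂
    (LinearMap.mk₂ ℝ (bracket N)
      (fun v v' w => Subtype.ext <| by
        simp only [bracket, tensor_add_left, tensor_add_right, Submodule.coe_add]; abel)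
      (fun c v w => Subtype.ext <| by
        simp only [bracket, tensor_smul_left, tensor_smul_right, Submodule.coe_smul, smul_sub])
      (fun v w w' => Subtype.ext <| by
        simp only [bracket, tensor_add_left, tensor_add_right, Submodule.coe_add]; abel)
      (fun c v w => Subtype.ext <| by
        simp only [bracket, tensor_smul_left, tensor_smul_right, Submodule.coe_smul, smul_sub]))
    2 (fun v w => by
      refine (norm_sub_le (tensor N v w) (tensor N w v)).trans ?_
      linarith [norm_tensor_le N v w, norm_tensor_le N w v, mul_comm ‖v‖ ‖w‖])

@[simp]
theorem bracketCLM_apply (v w : V) : bracketCLM N v w = bracket N v w := rfl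

theorem norm_bracket_le (v w : V) : ‖bracket N v w‖ ≤ 2 * ‖v‖ * ‖w‖ := by
  refine (norm_sub_le (tensor N v w) (tensor N w v)).trans ?_
  linarith [norm_tensor_le N v w, norm_tensor_le N w v, mul_comm ‖v‖ ‖w‖]

theorem bracket_swap (v w : V) : bracket N w v = -bracket N v w :=
  Subtype.ext (neg_sub _ _).symm

theorem bracket_self (v : V) : bracket N v v = 0 := Subtype.ext (sub_self _)

theorem bracket_ne_zero {v w : V} (h : LinearIndependent ℝ ![v, w]) : bracket N v w ≠ 0 := by
  intro h0
  have h1 : tensor N v w = tensor N w v := sub_eq_zero.1 (congrArg Subtype.val h0)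
  have h2 : (v ⊗ₜ[ℝ] w : V ⊗[ℝ] V) = w ⊗ₜ[ℝ] v :=
    UniformSpace.Completion.coe_injective (AlgTensor N) h1
  -- coordinates with respect to `v`, `w`, extended to all of `V`, separate the two tensors
  obtain ⟨g, hg⟩ := LinearMap.exists_leftInverse_of_injective
    (Finsupp.linearCombination ℝ ![v, w]) (LinearMap.ker_eq_bot.2 h)
  have hv : g v = Finsupp.single 0 1 := by
    simpa using LinearMap.congr_fun hg (Finsupp.single 0 1)
  have hw : g w = Finsupp.single 1 1 := by
    simpa using LinearMap.congr_fun hg (Finsupp.single 1 1)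
  have h3 := congrArg (fun z => TensorProduct.lid ℝ ℝ (TensorProduct.map
    (Finsupp.lapply 0 ∘ₗ g) (Finsupp.lapply 1 ∘ₗ g) z)) h2
  simp [hv, hw] at h3

instance : CompleteSpace (commutatorSpace N) :=
  inferInstanceAs (CompleteSpace (Submodule.topologicalClosure _))

theorem _root_.Filter.Tendsto.bracket {ι : Type*} {l : Filter ι} {f g : ι → V} {v w : V}
    (hf : Tendsto f l (𝓝 v)) (hg : Tendsto g l (𝓝 w)) :
    Tendsto (fun i => bracket N (f i) (g i)) l (𝓝 (bracket N v w)) := by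
  exact ((isBoundedBilinearMap_apply.continuous.tendsto (bracketCLM N v, w)).comp
    ((((bracketCLM N).continuous.tendsto v).comp hf).prodMk_nhds hg))

theorem HasStieltjesIntegral.exists_fineChain {E F W : Type*} [NormedAddCommGroup F]
    [NormedAddCommGroup W] {B : E → F → W} {f : Time T → E} {g : Time T → F} {s t : Time T} {I : W}
    (h : HasStieltjesIntegral B f g s t I) {ε : ℝ} (hε : 0 < ε) :
    ∃ δ : ℝ≥0, 0 < δ ∧ ∀ δ' ≤ δ, ∀ S,
      FineChain (fun x y => B (f x) (g y - g x)) δ' s t S → ‖S - I‖ < ε := by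
  obtain ⟨δ, hδ, H⟩ := h ε hε
  refine ⟨δ, hδ, fun δ' hδ' S hS => ?_⟩
  obtain ⟨D, hD, rfl⟩ := hS.exists_partition
  exact H D (hD.trans hδ') (fun j => D.pts j.castSucc)
    fun j => ⟨le_rfl, D.strictMono.monotone Fin.castSucc_lt_succ.le⟩

variable {N}

/-- Moving the base point of left Riemann sums. -/
theorem FineChain.bracket_base {γ : C(Time T, V)} (s t : Time T) {δ : ℝ≥0} {a u : Time T}
    {S : commutatorSpace N}
    (h : FineChain (fun x y => bracket N (γ x - γ t) (γ y - γ x)) δ a u S) :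
    FineChain (fun x y => bracket N (γ x - γ s) (γ y - γ x)) δ a u
      (S + bracket N (γ t - γ s) (γ u - γ a)) := by
  induction h with
  | nil =>
    convert FineChain.nil using 1
    simp [← bracketCLM_apply]
  | @snoc b c S _ hlt hd ih =>
    convert ih.snoc hlt hd using 1
    simp only [← bracketCLM_apply, map_sub, _root_.sub_apply]
    abel

/-- Chen's relation for the area. -/
theorem IsArea.chen {γ : C(Time T, V)} {a : Triangle T → commutatorSpace N} (h : IsArea N γ a)
    {s t u : Time T} (hst : s ≤ t) (htu : t ≤ u) :
    a ⟨(s, u), hst.trans htu⟩ = a ⟨(s, t), hst⟩ + a ⟨(t, u), htu⟩ +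
      (1 / 2 : ℝ) • bracket N (γ t - γ s) (γ u - γ t) := by
  obtain ⟨I, hI, e⟩ := h ⟨(s, u), hst.trans htu⟩
  obtain ⟨I₁, hI₁, e₁⟩ := h ⟨(s, t), hst⟩
  obtain ⟨I₂, hI₂, e₂⟩ := h ⟨(t, u), htu⟩
  rw [e, e₁, e₂, ← smul_add, ← smul_add]
  congr 1
  rw [← sub_eq_zero, ← norm_le_zero_iff]
  refine le_of_forall_pos_le_add fun ε hε => ?_
  have hε' : 0 < ε / 3 := by positivity
  have sub_base : ∀ (r x y : Time T),
      (γ y - γ r) - (γ x - γ r) = γ y - γ x := fun _ _ _ => by abel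
  obtain ⟨δ, hδ, H⟩ := hI.exists_fineChain hε'
  obtain ⟨δ₁, hδ₁, H₁⟩ := hI₁.exists_fineChain hε'
  obtain ⟨δ₂, hδ₂, H₂⟩ := hI₂.exists_fineChain hε'
  set d := min δ (min δ₁ δ₂)
  have hd : 0 < d := lt_min hδ (lt_min hδ₁ hδ₂)
  obtain ⟨S₁, h₁⟩ := FineChain.exists_of_le
    (fun x y => bracket N (γ x - γ s) (γ y - γ x)) hd hst
  obtain ⟨S₂, h₂⟩ := FineChain.exists_of_le
    (fun x y => bracket N (γ x - γ t) (γ y - γ x)) hd htu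
  have b := H d (min_le_left _ _) _ (h₁.trans (h₂.bracket_base s t))
  have b₁ := H₁ d ((min_le_right _ _).trans (min_le_left _ _)) _ h₁
  have b₂ := H₂ d ((min_le_right _ _).trans (min_le_right _ _)) _ h₂
  have key : I - (I₁ + I₂ + bracket N (γ t - γ s) (γ u - γ t)) =
      (S₁ - I₁) + (S₂ - I₂) - (S₁ + (S₂ + bracket N (γ t - γ s) (γ u - γ t)) - I) := by abel
  rw [key]
  refine (norm_sub_le _ _).trans ?_
  linarith [norm_add_le (S₁ - I₁) (S₂ - I₂)]

/-- Twice the area of the polygon with vertices `γ(t_0), …, γ(t_n)`, as a left Riemann sum. -/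
noncomputable def polygonArea (N : TensorNorm V) (γ : Time T → V) (D : Partition T 0 T) :
    commutatorSpace N :=
  ∑ j : Fin D.n, bracket N (γ (D.pts j.castSucc) - γ (D.pts 0))
    (γ (D.pts j.succ) - γ (D.pts j.castSucc))

theorem IsArea.polygonArea_eq {γ : C(Time T, V)} {a : Triangle T → commutatorSpace N}
    (h : IsArea N γ a) (D : Partition T 0 T) {z e : Time T} (hz : (z : ℝ) = 0) (he : (e : ℝ) = T)
    (hze : z ≤ e) :
    (1 / 2 : ℝ) • polygonArea N γ D = a ⟨(z, e), hze⟩ - ∑ j : Fin D.n, a (D.seg j) := by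
  have hz0 : D.pts 0 = z := Subtype.ext (D.first.trans hz.symm)
  have hzle : ∀ t : Time T, z ≤ t := fun t => Subtype.coe_le_coe.1 (hz.trans_le t.2.1)
  have hzz : a ⟨(z, z), le_rfl⟩ = 0 := by
    have := h.chen (le_refl z) (le_refl z)
    rw [sub_self, bracket_self, smul_zero, add_zero] at this
    simpa using this
  have tele := D.sum_sub (fun t => a ⟨(z, t), hzle t⟩) hz he
  rw [hzz, sub_zero] at tele
  rw [← tele, ← Finset.sum_sub_distrib, polygonArea, Finset.smul_sum]
  refine Finset.sum_congr rfl fun j _ => ?_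
  rw [h.chen (hzle _) (D.seg_le j), hz0, Partition.seg]
  abel

/-- A bound on the `1`-variation sums bounds the value at `(0, T)`. -/
theorem norm_le_of_forall_sum_le {E : Type*} [NormedAddCommGroup E] {α : Triangle T → E} {c : ℝ}
    {hT : 0 ≤ T} (hze : (⟨0, le_rfl, hT⟩ : Time T) < ⟨T, hT, le_rfl⟩)
    (h : ∀ D : Partition T 0 T, ∑ j : Fin D.n, ‖α (D.seg j)‖ ≤ c) :
    ‖α ⟨(⟨0, le_rfl, hT⟩, ⟨T, hT, le_rfl⟩), hze.le⟩‖ ≤ c := by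
  let D : Partition T 0 T := ⟨1, ![⟨0, le_rfl, hT⟩, ⟨T, hT, le_rfl⟩], by
    rw [Fin.strictMono_iff_lt_succ]; intro i; fin_cases i; exact hze, rfl, rfl⟩
  exact (Fin.sum_univ_one fun j : Fin 1 => ‖α (D.seg j)‖).symm.trans_le (h D)

/-- The obstruction to an enhancement: the polygonal areas of a path in `G₂` along all partitions
of small mesh are bounded. -/
theorem exists_norm_polygonArea_le (hT : 0 < T) {γ : C(Time T, V)} (hγ : γ ∈ G2 T N) :
    ∃ C : ℝ, ∃ δ : ℝ≥0, 0 < δ ∧ ∀ D : Partition T 0 T, D.mesh ≤ δ → ‖polygonArea N γ D‖ ≤ C := by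
  obtain ⟨-, α, ⟨-, hα⟩, -, γs, as, has, hlim⟩ := hγ
  obtain ⟨δ, hδ, Hδ⟩ := (vanishingPVar_iff one_pos).1 hα 1 one_pos
  set z : Time T := ⟨0, le_rfl, hT.le⟩
  set e : Time T := ⟨T, hT.le, le_rfl⟩
  have hze : z < e := hT
  refine ⟨2 * (‖α ⟨(z, e), hze.le⟩‖ + 1 + (1 + 1)), δ, hδ, fun D hD => ?_⟩
  -- both parts of the rough norm tend to zero
  have hsum : Tendsto (fun k => pVar 2 (incr (γ - γs k)) ^ 2 +
      pVar 1 (fun p => α p - as k p)) atTop (𝓝 0) := by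
    have := hlim.ennrpow_const 2
    simp only [roughNorm, ← ENNReal.rpow_mul] at this
    simpa using this
  have hvar1 : ∀ᶠ k in atTop, pVar 1 (fun p => α p - as k p) ≤ ENNReal.ofReal 1 := by
    filter_upwards [hsum.eventually_le_const (u := ENNReal.ofReal 1) (by simp)] with k hk
    exact le_add_self.trans hk
  have hvar2 : Tendsto (fun k => pVar 2 (incr (γ - γs k))) atTop (𝓝 0) := by
    have h2 : Tendsto (fun k => pVar 2 (incr (γ - γs k)) ^ (2 : ℝ)) atTop (𝓝 0) :=
      tendsto_of_tendsto_of_tendsto_of_le_of_le tendsto_const_nhds hsum (fun _ => zero_le)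
        fun k => by simp
    have := h2.ennrpow_const (1 / 2)
    simp only [← ENNReal.rpow_mul] at this
    simpa using this
  have hpt : ∀ s t : Time T, s ≤ t →
      Tendsto (fun k => γs k t - γs k s) atTop (𝓝 (γ t - γ s)) := by
    intro s t hst
    rw [tendsto_iff_norm_sub_tendsto_zero]
    have : Tendsto (fun k => ENNReal.ofReal ‖(γ - γs k) t - (γ - γs k) s‖) atTop (𝓝 0) :=
      tendsto_of_tendsto_of_tendsto_of_le_of_le tendsto_const_nhds hvar2 (fun _ => zero_le)
        fun k => norm_sub_le_pVar _ hst
    have := (ENNReal.tendsto_toReal ENNReal.zero_ne_top).comp this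
    refine (this.congr fun k => ?_).trans (by simp)
    simp only [Function.comp, ENNReal.toReal_ofReal (norm_nonneg _), ContinuousMap.sub_apply]
    rw [norm_sub_rev (γs k t - γs k s)]
    congr 1; abel
  have hpoly : Tendsto (fun k => polygonArea N (γs k) D) atTop (𝓝 (polygonArea N γ D)) := by
    refine tendsto_finsetSum _ fun j _ => ?_
    have h0 := hpt _ _ (D.strictMono.monotone (Fin.zero_le j.castSucc))
    have h1 := hpt _ _ (D.seg_le j)
    exact h0.bracket N h1
  refine le_of_tendsto hpoly.norm ?_
  filter_upwards [hvar1] with k hk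
  rw [pVar_le_ofReal_iff one_pos zero_le_one] at hk
  simp only [Real.rpow_one] at hk Hδ
  have hpol := (has k).2.polygonArea_eq D (z := z) (e := e) rfl rfl hze.le
  -- the trivial partition bounds `α - as k` at `(0, T)`
  have h1 : ‖as k ⟨(z, e), hze.le⟩‖ ≤ ‖α ⟨(z, e), hze.le⟩‖ + 1 := by
    have h' := norm_le_of_forall_sum_le (hT := hT.le) (α := fun p => α p - as k p) hze hk
    rw [norm_sub_rev] at h'
    linarith [norm_sub_norm_le (as k ⟨(z, e), hze.le⟩) (α ⟨(z, e), hze.le⟩)]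
  have h2 : ‖∑ j : Fin D.n, as k (D.seg j)‖ ≤ 1 + 1 := by
    refine (norm_sum_le _ _).trans ((Finset.sum_le_sum fun j _ => ?_).trans
      (Finset.sum_add_distrib.trans_le (add_le_add (Hδ D hD) (hk D))))
    rw [norm_sub_rev]
    linarith [norm_sub_norm_le (as k (D.seg j)) (α (D.seg j))]
  have h3 := norm_sub_le (as k ⟨(z, e), hze.le⟩) (∑ j : Fin D.n, as k (D.seg j))
  rw [← hpol, norm_smul, Real.norm_of_nonneg one_half_pos.le] at h3
  linarith

end RoughArea

/-! ### Density of the paths which can be enhanced -/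

namespace RoughArea

variable {T : ℝ} {V : Type*} [NormedAddCommGroup V] [NormedSpace ℝ V] {N : TensorNorm V}

theorem Partition.sum_sq_length_le {a b : ℝ} (D : Partition T a b) {δ : ℝ} (hD : D.mesh ≤ δ) :
    ∑ j : Fin D.n, ((D.pts j.succ : ℝ) - D.pts j.castSucc) ^ 2 ≤ δ * (b - a) := by
  rw [← D.sum_length, Finset.mul_sum]
  refine Finset.sum_le_sum fun j _ => ?_
  rw [sq]
  exact mul_le_mul_of_nonneg_right ((D.length_le_mesh j).trans hD)
    (sub_nonneg.2 (D.strictMono.monotone Fin.castSucc_lt_succ.le))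

/-- For a `C¹` path with primitive `Ψ` of `[y, y']`, the tagged Stieltjes summand `[y(ξ), y(v) - y(u)]`
agrees with `Ψ(v) - Ψ(u)` to second order. -/
theorem norm_bracket_sub_primitive_le {y y' : ℝ → V} {Ψ : ℝ → commutatorSpace N} {L : ℝ}
    (hy : ∀ r, HasDerivAt y (y' r) r) (hL : ∀ r, ‖y' r‖ ≤ L)
    (hΨ : ∀ r, HasDerivAt Ψ (bracket N (y r) (y' r)) r) {u v ξ : ℝ} (hu : u ≤ ξ) (hv : ξ ≤ v) :
    ‖bracket N (y ξ) (y v - y u) - (Ψ v - Ψ u)‖ ≤ 2 * L ^ 2 * (v - u) ^ 2 := by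
  have hL0 : 0 ≤ L := (norm_nonneg _).trans (hL 0)
  have hlip : ∀ a b, ‖y b - y a‖ ≤ L * |b - a| := fun a b => by
    simpa using convex_univ.norm_image_sub_le_of_norm_hasDerivWithin_le
      (fun r _ => (hy r).hasDerivWithinAt) (fun r _ => hL r) (mem_univ a) (mem_univ b)
  have hderiv : ∀ r, HasDerivAt (fun r => bracketCLM N (y ξ) (y r) - Ψ r)
      (bracket N (y ξ - y r) (y' r)) r := fun r => by
    have := ((bracketCLM N (y ξ)).hasFDerivAt.comp_hasDerivAt r (hy r)).sub (hΨ r)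
    rw [← bracketCLM_apply, map_sub, _root_.sub_apply]
    exact this
  have hbound : ∀ r ∈ Icc u v, ‖bracket N (y ξ - y r) (y' r)‖ ≤ 2 * (L * (v - u)) * L := by
    intro r hr
    refine (norm_bracket_le N _ _).trans ?_
    have h1 : ‖y ξ - y r‖ ≤ L * (v - u) := (hlip r ξ).trans <|
      mul_le_mul_of_nonneg_left (abs_sub_le_iff.2 ⟨by linarith [hr.1], by linarith [hr.2]⟩) hL0
    exact mul_le_mul (mul_le_mul_of_nonneg_left h1 two_pos.le) (hL r) (norm_nonneg _)
      (mul_nonneg two_pos.le ((norm_nonneg _).trans h1))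
  have := norm_image_sub_le_of_norm_deriv_le_segment'
    (fun r _ => (hderiv r).hasDerivWithinAt (s := Icc u v))
    (fun r hr => hbound r (Ico_subset_Icc_self hr)) v ⟨hu.trans hv, le_rfl⟩
  simp only [bracketCLM_apply] at this
  have e : bracket N (y ξ) (y v - y u) - (Ψ v - Ψ u) =
      bracket N (y ξ) (y v) - Ψ v - (bracket N (y ξ) (y u) - Ψ u) := by
    simp only [← bracketCLM_apply, map_sub]; abel
  rw [e]
  refine this.trans (le_of_eq (by ring))

/-- A `C¹` path can be enhanced to a geometric rough path, by its own area. -/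
theorem mem_G2_of_hasDerivAt [CompleteSpace V] (hT : 0 < T) {γ : C(Time T, V)} {y y' : ℝ → V}
    {L : ℝ} (hy : ∀ r, HasDerivAt y (y' r) r) (hy' : Continuous y') (hL : ∀ r, ‖y' r‖ ≤ L)
    (hγ : ∀ t : Time T, γ t = y t) : γ ∈ G2 T N := by
  have hL0 : 0 ≤ L := (norm_nonneg _).trans (hL 0)
  have hyc : Continuous y := continuous_iff_continuousAt.2 fun r => (hy r).continuousAt
  have hlip : ∀ a b, ‖y b - y a‖ ≤ L * |b - a| := fun a b => by
    simpa using convex_univ.norm_image_sub_le_of_norm_hasDerivWithin_le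
      (fun r _ => (hy r).hasDerivWithinAt) (fun r _ => hL r) (mem_univ a) (mem_univ b)
  have hincr : ∀ q : Triangle T, ‖incr γ q‖ ≤ L * (q.1.2 - q.1.1) := fun q => by
    have := hlip q.1.1 q.1.2
    rw [abs_of_nonneg (sub_nonneg.2 (Subtype.coe_le_coe.2 q.2))] at this
    rwa [incr, hγ, hγ]
  have hBc : Continuous fun r => bracket N (y r) (y' r) :=
    continuous_iff_continuousAt.2 fun r =>
      (hyc.tendsto r).bracket N (hy'.tendsto r)
  obtain ⟨Ψ, hΨ⟩ : ∃ Ψ : ℝ → commutatorSpace N,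
      ∀ r, HasDerivAt Ψ (bracket N (y r) (y' r)) r :=
    ⟨fun r => ∫ u in (0 : ℝ)..r, bracket N (y u) (y' u),
      fun r => (hBc.integral_hasStrictDerivAt 0 r).hasDerivAt⟩
  have hΨc : Continuous Ψ := continuous_iff_continuousAt.2 fun r => (hΨ r).continuousAt
  -- the area of `γ`
  let A : Triangle T → commutatorSpace N := fun q =>
    (1 / 2 : ℝ) • (Ψ q.1.2 - Ψ q.1.1 - bracket N (y q.1.1) (y q.1.2 - y q.1.1))
  have hAc : Continuous A := by
    have h1 : Continuous fun q : Triangle T => (q.1.1 : ℝ) := by fun_prop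
    have h2 : Continuous fun q : Triangle T => (q.1.2 : ℝ) := by fun_prop
    refine (((hΨc.comp h2).sub (hΨc.comp h1)).sub ?_).const_smul (1 / 2 : ℝ)
    exact continuous_iff_continuousAt.2 fun q =>
      ((hyc.comp h1).tendsto q).bracket N (((hyc.comp h2).sub (hyc.comp h1)).tendsto q)
  have hA : IsArea N γ A := by
    intro q
    refine ⟨_, fun ε hε => ?_, rfl⟩
    have hpos : 0 < 2 * L ^ 2 * T + 1 := by positivity
    refine ⟨⟨ε / (2 * L ^ 2 * T + 1), by positivity⟩, by
      exact (div_pos hε hpos : (0 : ℝ) < ε / (2 * L ^ 2 * T + 1)), fun D hD ξ hξ => ?_⟩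
    have hD' : (D.mesh : ℝ) ≤ ε / (2 * L ^ 2 * T + 1) := hD
    have tΨ := D.sum_sub (fun t => Ψ t) rfl rfl
    have ty := D.sum_sub (fun t => bracketCLM N (y q.1.1) (y t)) rfl rfl
    have hsum : ∑ j : Fin D.n, bracket N (γ (ξ j) - γ q.1.1)
          (γ (D.pts j.succ) - γ (D.pts j.castSucc)) -
        (Ψ q.1.2 - Ψ q.1.1 - bracket N (y q.1.1) (y q.1.2 - y q.1.1)) =
        ∑ j : Fin D.n, (bracket N (y (ξ j)) (y (D.pts j.succ) - y (D.pts j.castSucc)) -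
          (Ψ (D.pts j.succ) - Ψ (D.pts j.castSucc))) := by
      rw [Finset.sum_sub_distrib, tΨ]
      have : bracket N (y q.1.1) (y q.1.2 - y q.1.1) = ∑ j : Fin D.n,
          bracket N (y q.1.1) (y (D.pts j.succ) - y (D.pts j.castSucc)) := by
        simp only [← bracketCLM_apply, map_sub]
        exact ty.symm
      have e : ∑ j : Fin D.n, bracket N (γ (ξ j) - γ q.1.1)
          (γ (D.pts j.succ) - γ (D.pts j.castSucc)) =
          ∑ j : Fin D.n, bracket N (y (ξ j)) (y (D.pts j.succ) - y (D.pts j.castSucc)) -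
          bracket N (y q.1.1) (y q.1.2 - y q.1.1) := by
        rw [this, ← Finset.sum_sub_distrib]
        refine Finset.sum_congr rfl fun j _ => ?_
        simp only [hγ, ← bracketCLM_apply]
        rw [← _root_.sub_apply, ← map_sub]
      rw [e]
      abel
    rw [hsum]
    calc _ ≤ ∑ j : Fin D.n, 2 * L ^ 2 * ((D.pts j.succ : ℝ) - D.pts j.castSucc) ^ 2 :=
          norm_sum_le_of_le _ fun j _ =>
            norm_bracket_sub_primitive_le hy hL hΨ (hξ j).1 (hξ j).2
      _ ≤ 2 * L ^ 2 * (ε / (2 * L ^ 2 * T + 1) * T) := by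
          rw [← Finset.mul_sum]
          refine mul_le_mul_of_nonneg_left ((D.sum_sq_length_le hD').trans ?_) (by positivity)
          refine mul_le_mul_of_nonneg_left ?_ (by positivity)
          linarith [q.1.1.2.1, q.1.2.2.2]
      _ < ε := by
          rw [← mul_assoc, mul_comm, ← mul_assoc, mul_div_assoc', div_lt_iff₀ hpos]
          nlinarith
  have hAle : ∀ q : Triangle T, ‖A q‖ ≤ L ^ 2 * (q.1.2 - q.1.1 : ℝ) ^ 2 := fun q => by
    have := norm_bracket_sub_primitive_le hy hL hΨ (le_refl (q.1.1 : ℝ))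
      (Subtype.coe_le_coe.2 q.2)
    rw [norm_sub_rev] at this
    simp only [A]
    rw [norm_smul, Real.norm_of_nonneg one_half_pos.le]
    linarith
  refine ⟨?_, ⟨A, hAc⟩, ⟨?_, ?_⟩, ?_, fun _ => γ, fun _ => A, fun _ => ⟨?_, hA⟩, ?_⟩
  · refine vanishingPVar_of_little_holder two_pos hT fun ε hε =>
      ⟨ε / (L ^ 2 + 1), by positivity, fun q hq => ?_⟩
    have h0 : (0 : ℝ) ≤ q.1.2 - q.1.1 := sub_nonneg.2 (Subtype.coe_le_coe.2 q.2)
    rw [le_div_iff₀ (by positivity)] at hq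
    rw [Real.rpow_two]
    calc ‖incr γ q‖ ^ 2 ≤ (L * (q.1.2 - q.1.1)) ^ 2 := by gcongr; exact hincr q
      _ = (q.1.2 - q.1.1) * L ^ 2 * (q.1.2 - q.1.1) := by ring
      _ ≤ ε * (q.1.2 - q.1.1) := by gcongr; nlinarith
  · intro t
    exact norm_le_zero_iff.1 ((hAle _).trans (by simp))
  · refine vanishingPVar_of_little_holder one_pos hT fun ε hε =>
      ⟨ε / (L ^ 2 + 1), by positivity, fun q hq => ?_⟩
    have h0 : (0 : ℝ) ≤ q.1.2 - q.1.1 := sub_nonneg.2 (Subtype.coe_le_coe.2 q.2)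
    rw [le_div_iff₀ (by positivity)] at hq
    rw [Real.rpow_one]
    calc ‖A q‖ ≤ L ^ 2 * (q.1.2 - q.1.1 : ℝ) ^ 2 := hAle q
      _ = (q.1.2 - q.1.1) * L ^ 2 * (q.1.2 - q.1.1) := by ring
      _ ≤ ε * (q.1.2 - q.1.1) := by gcongr; nlinarith
  · intro t
    exact norm_le_zero_iff.1 ((hAle _).trans (by simp))
  · exact (pVar_le_of_holder one_pos (C := L) (c := L * T)
      (fun q => by rw [Real.rpow_one]; exact hincr q) (by positivity)
      (by rw [Real.rpow_one])).trans_lt ENNReal.ofReal_lt_top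
  · have h1 : pVar 2 (incr (γ - γ)) = 0 := by
      rw [← nonpos_iff_eq_zero, ← ENNReal.ofReal_zero, pVar_le_ofReal_iff two_pos le_rfl]
      simp [incr]
    have h2 : pVar 1 (fun q => A q - A q) = 0 := by
      rw [← nonpos_iff_eq_zero, ← ENNReal.ofReal_zero, pVar_le_ofReal_iff one_pos le_rfl]
      simp
    refine tendsto_const_nhds.congr fun _ => ?_
    change 0 = roughNorm N (γ - γ) fun q => A q - A q
    rw [roughNorm, h1, h2]
    simp

/-- Translates of a path of vanishing `2`-variation, extended constantly beyond `T`, converge to it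
in `2`-variation: the increments over intervals of length at most `δ` are controlled by the
vanishing `2`-variation, and there are few longer ones. -/
theorem exists_sum_translate_le {E : Type*} [NormedAddCommGroup E] (hT : 0 < T) {γ : C(Time T, E)}
    (hγ : γ ∈ vanishingPaths T E 2) {ε : ℝ} (hε : 0 < ε) :
    ∃ h : ℝ, 0 < h ∧ ∀ u ∈ Icc 0 h, ∀ D : Partition T 0 T,
      ∑ j : Fin D.n, ‖(γ (D.pts j.succ) - γ (D.pts j.castSucc)) -
        (γ (projIcc 0 T hT.le (D.pts j.succ + u)) -
          γ (projIcc 0 T hT.le (D.pts j.castSucc + u)))‖ ^ 2 ≤ ε := by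
  obtain ⟨δ, hδ, Hδ⟩ := vanishingPaths_two_iff.1 hγ (ε / 8) (by positivity)
  have hδ' : (0 : ℝ) < δ := hδ
  set m : ℝ := Real.sqrt (ε * δ / (8 * T)) with hm
  have hm0 : 0 < m := Real.sqrt_pos.2 (by positivity)
  have hm2 : m ^ 2 = ε * δ / (8 * T) := Real.sq_sqrt (by positivity)
  obtain ⟨h, hh, Hh⟩ := Metric.uniformContinuous_iff.1
    (CompactSpace.uniformContinuous_of_continuous γ.continuous) m hm0
  refine ⟨h / 2, by positivity, fun u hu D => ?_⟩
  obtain ⟨x, hx, h0, hn, hxD⟩ := D.exists_seq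
  set x' : ℕ → Time T := fun k => projIcc 0 T hT.le (x k + u) with hx'
  have hx'm : Monotone x' := fun k l hkl => monotone_projIcc _ (by
    have := Subtype.coe_le_coe.2 (hx hkl); linarith)
  have hval : ∀ k, (x' k : ℝ) = min T (x k + u) := fun k => by
    rw [hx', coe_projIcc, max_eq_right]
    exact le_min hT.le (add_nonneg (x k).2.1 hu.1)
  have hclose : ∀ k, ‖γ (x k) - γ (x' k)‖ ≤ m := fun k => by
    rw [← dist_eq_norm]
    refine (Hh ?_).le
    rw [Subtype.dist_eq, Real.dist_eq, hval, abs_lt]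
    have := (x k).2.2
    rcases min_cases T ((x k : ℝ) + u) with ⟨e, e'⟩ | ⟨e, e'⟩ <;> rw [e] <;>
      constructor <;> linarith [hu.1, hu.2]
  set F : Time T → Time T → ℝ := fun s t => ‖γ t - γ s‖ ^ 2 with hFdef
  have hF : ∀ s t, 0 ≤ F s t := fun _ _ => by positivity
  have hF0 : ∀ t, F t t = 0 := fun _ => by simp [hFdef]
  have b₁ := sum_short_le hF hF0 hδ Hδ hx D.n
  have b₂ := sum_short_le hF hF0 hδ Hδ hx'm D.n
  have hlen : ∑ k ∈ Finset.range D.n, ((x (k + 1) : ℝ) - x k) = T := by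
    rw [Finset.sum_range_sub (fun k => (x k : ℝ)), h0, hn, sub_zero]
  have hterm : ∀ k, ‖(γ (x (k + 1)) - γ (x k)) - (γ (x' (k + 1)) - γ (x' k))‖ ^ 2 ≤
      2 * (if (x (k + 1) : ℝ) - x k ≤ δ then F (x k) (x (k + 1)) else 0) +
      2 * (if (x' (k + 1) : ℝ) - x' k ≤ δ then F (x' k) (x' (k + 1)) else 0) +
      4 * m ^ 2 / δ * (x (k + 1) - x k) := by
    intro k
    have hk : (0 : ℝ) ≤ x (k + 1) - x k := sub_nonneg.2 (Subtype.coe_le_coe.2 (hx k.le_succ))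
    by_cases hs : (x (k + 1) : ℝ) - x k ≤ δ
    · have hs' : (x' (k + 1) : ℝ) - x' k ≤ δ := by
        rw [hval, hval]
        rcases min_cases T ((x k : ℝ) + u) with ⟨e, e'⟩ | ⟨e, e'⟩ <;> rw [e]
        · linarith [min_le_left T ((x (k + 1) : ℝ) + u)]
        · linarith [min_le_right T ((x (k + 1) : ℝ) + u)]
      rw [if_pos hs, if_pos hs']
      have h3 : 0 ≤ 4 * m ^ 2 / δ * ((x (k + 1) : ℝ) - x k) := by positivity
      have h4 := pow_le_pow_left₀ (norm_nonneg _)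
        (norm_sub_le (γ (x (k + 1)) - γ (x k)) (γ (x' (k + 1)) - γ (x' k))) 2
      have h5 := add_sq_le (a := ‖γ (x (k + 1)) - γ (x k)‖) (b := ‖γ (x' (k + 1)) - γ (x' k)‖)
      simp only [hFdef]
      linarith
    · have h3 : 0 ≤ 2 * (if (x' (k + 1) : ℝ) - x' k ≤ δ then F (x' k) (x' (k + 1)) else 0) := by
        split_ifs
        · exact mul_nonneg two_pos.le (hF _ _)
        · simp
      rw [if_neg hs, mul_zero, zero_add]
      push Not at hs
      have h4 : ‖(γ (x (k + 1)) - γ (x k)) - (γ (x' (k + 1)) - γ (x' k))‖ ≤ m + m := by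
        rw [sub_sub_sub_comm]
        exact (norm_sub_le _ _).trans (add_le_add (hclose _) (hclose _))
      have h5 : 4 * m ^ 2 ≤ 4 * m ^ 2 / δ * (x (k + 1) - x k) := by
        rw [div_mul_eq_mul_div, le_div_iff₀ hδ']
        exact mul_le_mul_of_nonneg_left hs.le (by positivity)
      have h6 := pow_le_pow_left₀ (norm_nonneg _) h4 2
      nlinarith
  calc _ = ∑ k ∈ Finset.range D.n,
        ‖(γ (x (k + 1)) - γ (x k)) - (γ (x' (k + 1)) - γ (x' k))‖ ^ 2 := by
        rw [← Fin.sum_univ_eq_sum_range (fun k =>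
          ‖(γ (x (k + 1)) - γ (x k)) - (γ (x' (k + 1)) - γ (x' k))‖ ^ 2)]
        exact Finset.sum_congr rfl fun j _ => by rw [(hxD j).1, (hxD j).2]
    _ ≤ _ := Finset.sum_le_sum fun k _ => hterm k
    _ ≤ 2 * (ε / 8) + 2 * (ε / 8) + 4 * m ^ 2 / δ * T := by
        rw [Finset.sum_add_distrib, Finset.sum_add_distrib, ← Finset.mul_sum, ← Finset.mul_sum,
          ← Finset.mul_sum, hlen]
        gcongr
    _ = ε := by rw [hm2]; field_simp; ring

/-- The moving averages `t ↦ h⁻¹ ∫_t^{t+h} γ` of a path of vanishing `2`-variation are `C¹` and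
converge to it in `2`-variation. -/
theorem exists_mem_G2_near [CompleteSpace V] (N : TensorNorm V) (hT : 0 < T) {γ : C(Time T, V)}
    (hγ : γ ∈ vanishingPaths T V 2) {c : ℝ} (hc : 0 < c) :
    ∃ η ∈ G2 T N, pVar 2 (incr (γ - η)) ≤ ENNReal.ofReal c := by
  obtain ⟨h, hh, H⟩ := exists_sum_translate_le hT hγ (ε := c ^ 2) (by positivity)
  set g : ℝ → V := fun t => γ (projIcc 0 T hT.le t) with hg
  have hgc : Continuous g := γ.continuous.comp continuous_projIcc
  set y : ℝ → V := fun t => h⁻¹ • ∫ u in (0 : ℝ)..h, g (t + u) with hy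
  have hy_eq : ∀ t, y t = h⁻¹ • ((∫ u in (0 : ℝ)..(t + h), g u) - ∫ u in (0 : ℝ)..t, g u) := by
    intro t
    simp only [hy]
    rw [intervalIntegral.integral_comp_add_left (fun u => g u), add_zero,
      intervalIntegral.integral_interval_sub_left (hgc.intervalIntegrable _ _)
        (hgc.intervalIntegrable _ _)]
  have hderiv : ∀ t, HasDerivAt y (h⁻¹ • (g (t + h) - g t)) t := by
    intro t
    rw [funext hy_eq]
    exact (((hgc.integral_hasStrictDerivAt 0 (t + h)).hasDerivAt.comp_add_const t h).sub
      (hgc.integral_hasStrictDerivAt 0 t).hasDerivAt).const_smul h⁻¹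
  have hyc : Continuous y := continuous_iff_continuousAt.2 fun r => (hderiv r).continuousAt
  refine ⟨⟨fun t => y t, hyc.comp continuous_subtype_val⟩,
    mem_G2_of_hasDerivAt hT hderiv (by fun_prop) (L := h⁻¹ * (‖γ‖ + ‖γ‖)) (fun r => ?_)
      fun t => rfl, ?_⟩
  · rw [norm_smul, Real.norm_of_nonneg (by positivity)]
    gcongr
    exact (norm_sub_le _ _).trans (add_le_add (γ.norm_coe_le_norm _) (γ.norm_coe_le_norm _))
  rw [pVar_le_ofReal_iff two_pos hc.le]
  intro D
  -- the increments of `γ - η` along `D` are the average of those of `γ - γ(· + u)`, as vectors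
  -- in an `ℓ²` sum of copies of `V`
  let X : ℝ → PiLp 2 (fun _ : Fin D.n => V) := fun u => WithLp.toLp 2 fun j =>
    (γ (D.pts j.succ) - γ (D.pts j.castSucc)) - (g (D.pts j.succ + u) - g (D.pts j.castSucc + u))
  have hXc : Continuous X := by
    refine (PiLp.continuous_toLp 2 _).comp (continuous_pi fun j => ?_)
    fun_prop
  have hXle : ∀ u ∈ Icc 0 h, ‖X u‖ ≤ c := fun u hu => by
    have := H u hu D
    rw [← abs_of_nonneg hc.le, ← abs_of_nonneg (norm_nonneg (X u)), ← sq_le_sq,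
      PiLp.norm_sq_eq_of_L2]
    exact this
  have havg : ‖h⁻¹ • ∫ u in (0 : ℝ)..h, X u‖ ≤ c := by
    rw [norm_smul, Real.norm_of_nonneg (by positivity)]
    have := intervalIntegral.norm_integral_le_of_norm_le_const (a := 0) (b := h) (f := X) (C := c)
      fun u hu => hXle u (by rw [uIoc_of_le hh.le] at hu; exact Ioc_subset_Icc_self hu)
    rw [sub_zero, abs_of_pos hh] at this
    calc _ ≤ h⁻¹ * (c * h) := by gcongr
      _ = c := by field_simp
  have hcoord : ∀ j : Fin D.n, (h⁻¹ • ∫ u in (0 : ℝ)..h, X u) j =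
      (γ (D.pts j.succ) - γ (D.pts j.castSucc)) - (y (D.pts j.succ) - y (D.pts j.castSucc)) := by
    intro j
    have h1 := (PiLp.proj (𝕜 := ℝ) 2 (fun _ : Fin D.n => V) j).intervalIntegral_comp_comm
      (hXc.intervalIntegrable (μ := volume) 0 h)
    rw [PiLp.smul_apply]
    change h⁻¹ • (PiLp.proj (𝕜 := ℝ) 2 (fun _ : Fin D.n => V) j) (∫ u in (0 : ℝ)..h, X u) = _
    rw [← h1]
    simp only [PiLp.proj_apply, X]
    have i1 : ∀ a : ℝ, IntervalIntegrable (fun u => g (a + u)) volume 0 h := fun a =>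
      (hgc.comp (by fun_prop)).intervalIntegrable _ _
    rw [intervalIntegral.integral_sub (by simp) ((i1 _).sub (i1 _)),
      intervalIntegral.integral_sub (i1 _) (i1 _), intervalIntegral.integral_const, sub_zero,
      smul_sub, inv_smul_smul₀ hh.ne', smul_sub]
  have hsq := pow_le_pow_left₀ (norm_nonneg _) havg 2
  rw [PiLp.norm_sq_eq_of_L2] at hsq
  simp only [Real.rpow_two]
  refine (Finset.sum_congr rfl fun j _ => ?_).trans_le hsq
  rw [hcoord, incr, Partition.seg]
  simp only [ContinuousMap.sub_apply, ContinuousMap.coe_mk]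
  congr 2
  abel

end RoughArea

/-! ### A lacunary loop of infinite area -/

namespace RoughArea

theorem norm_exp_ofReal_mul_I_sub_le (x y : ℝ) :
    ‖Complex.exp (x * Complex.I) - Complex.exp (y * Complex.I)‖ ≤ min 2 |x - y| := by
  refine le_min ?_ ?_
  · refine (norm_sub_le _ _).trans ?_
    rw [Complex.norm_exp_ofReal_mul_I, Complex.norm_exp_ofReal_mul_I]
    norm_num
  · have : Complex.exp (x * Complex.I) - Complex.exp (y * Complex.I) =
        Complex.exp (y * Complex.I) * (Complex.exp (Complex.I * ((x - y : ℝ) : ℂ)) - 1) := by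
      rw [mul_sub, mul_one, ← Complex.exp_add]
      congr 2
      push_cast; ring
    rw [this, norm_mul, Complex.norm_exp_ofReal_mul_I, one_mul]
    exact Real.norm_exp_I_mul_ofReal_sub_one_le

/-- The circle traversed `4 ^ k` times on the unit interval. -/
noncomputable def circleMode (k : ℕ) (t : ℝ) : ℂ :=
  Complex.exp ((2 * Real.pi * 4 ^ k * t : ℝ) * Complex.I)

theorem norm_circleMode (k : ℕ) (t : ℝ) : ‖circleMode k t‖ = 1 :=
  Complex.norm_exp_ofReal_mul_I _

theorem norm_circleMode_sub_le (k : ℕ) (s t : ℝ) :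
    ‖circleMode k t - circleMode k s‖ ≤ min 2 (2 * Real.pi * 4 ^ k * |t - s|) := by
  refine (norm_exp_ofReal_mul_I_sub_le _ _).trans_eq ?_
  rw [← mul_sub, abs_mul, abs_of_nonneg (by positivity)]

/-- The frequencies `4 ^ k ≤ 1 / h` and those above both contribute `O(√h)`. -/
theorem sum_min_le_sqrt {h : ℝ} (h0 : 0 ≤ h) (h1 : h ≤ 1) (M : ℕ) :
    ∑ k ∈ Finset.range M, (1 / 2 : ℝ) ^ k * min 2 (2 * Real.pi * 4 ^ k * h) ≤
      16 * Real.sqrt h := by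
  rcases h0.eq_or_lt with rfl | hpos
  · simp
  obtain ⟨n, hn, hn'⟩ := exists_nat_pow_near_of_lt_one hpos h1 (y := (1 / 4 : ℝ))
    (by norm_num) (by norm_num)
  have hs0 : 0 < Real.sqrt h := Real.sqrt_pos.2 hpos
  have hsq : Real.sqrt h ^ 2 = h := Real.sq_sqrt h0
  have hfour : ∀ k : ℕ, (1 / 4 : ℝ) ^ k = ((1 / 2 : ℝ) ^ k) ^ 2 := fun k => by
    rw [← pow_mul, mul_comm, pow_mul]; norm_num
  have hlo : (1 / 2 : ℝ) ^ (n + 1) < Real.sqrt h := by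
    rw [hfour, ← hsq] at hn
    exact (pow_lt_pow_iff_left₀ (by positivity) hs0.le two_ne_zero).1 hn
  have hhi : Real.sqrt h ≤ (1 / 2 : ℝ) ^ n := by
    rw [hfour, ← hsq] at hn'
    exact (pow_le_pow_iff_left₀ hs0.le (by positivity) two_ne_zero).1 hn'
  have hpq : (2 : ℝ) ^ n * (1 / 2) ^ n = 1 := by rw [← mul_pow]; norm_num
  have hnonneg : ∀ k : ℕ, 0 ≤ (1 / 2 : ℝ) ^ k * min 2 (2 * Real.pi * 4 ^ k * h) := fun k => by
    have : 0 ≤ min 2 (2 * Real.pi * 4 ^ k * h) := le_min two_pos.le (by positivity)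
    positivity
  calc _ ≤ ∑ k ∈ Finset.range (n + M), (1 / 2 : ℝ) ^ k * min 2 (2 * Real.pi * 4 ^ k * h) :=
        Finset.sum_le_sum_of_subset_of_nonneg (Finset.range_mono (by omega))
          fun k _ _ => hnonneg k
    _ = (∑ k ∈ Finset.range n, (1 / 2 : ℝ) ^ k * min 2 (2 * Real.pi * 4 ^ k * h)) +
        ∑ k ∈ Finset.range M, (1 / 2 : ℝ) ^ (n + k) * min 2 (2 * Real.pi * 4 ^ (n + k) * h) :=
        Finset.sum_range_add _ _ _
    _ ≤ (∑ k ∈ Finset.range n, 2 * Real.pi * h * 2 ^ k) +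
        ∑ k ∈ Finset.range M, 2 * (1 / 2 : ℝ) ^ n * (1 / 2) ^ k := by
        refine add_le_add (Finset.sum_le_sum fun k _ => ?_) (Finset.sum_le_sum fun k _ => ?_)
        · have h24 : (1 / 2 : ℝ) ^ k * 4 ^ k = 2 ^ k := by rw [← mul_pow]; norm_num
          calc _ ≤ (1 / 2 : ℝ) ^ k * (2 * Real.pi * 4 ^ k * h) := by
                gcongr; exact min_le_right _ _
            _ = 2 * Real.pi * h * ((1 / 2 : ℝ) ^ k * 4 ^ k) := by ring
            _ = _ := by rw [h24]
        · calc _ ≤ (1 / 2 : ℝ) ^ (n + k) * 2 := by gcongr; exact min_le_left _ _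
            _ = _ := by rw [pow_add]; ring
    _ ≤ 2 * Real.pi * h * 2 ^ n + 2 * (1 / 2 : ℝ) ^ n * 2 := by
        rw [← Finset.mul_sum, ← Finset.mul_sum]
        refine add_le_add (mul_le_mul_of_nonneg_left ?_ (by positivity))
          (mul_le_mul_of_nonneg_left (sum_geometric_two_le M) (by positivity))
        rw [geom_sum_eq (by norm_num)]
        norm_num
    _ ≤ 8 * Real.sqrt h + 8 * Real.sqrt h := by
        refine add_le_add ?_ ?_
        · have : Real.sqrt h * 2 ^ n ≤ 1 := by
            rw [← hpq, mul_comm]; gcongr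
          calc 2 * Real.pi * h * 2 ^ n = 2 * Real.pi * Real.sqrt h * (Real.sqrt h * 2 ^ n) := by
                nth_rewrite 1 [← hsq]; ring
            _ ≤ 2 * 4 * Real.sqrt h * 1 := by
                gcongr
                exact Real.pi_le_four
            _ = _ := by ring
        · rw [pow_succ] at hlo
          linarith
    _ = _ := by ring

/-- The lacunary series with coefficients `a`. -/
noncomputable def lacunary (a : ℕ → ℝ) (t : ℝ) : ℂ := ∑' k, (a k : ℂ) * circleMode k t

theorem summable_lacunary {a : ℕ → ℝ} {c : ℝ} (ha : ∀ k, |a k| ≤ c * (1 / 2) ^ k) (t : ℝ) :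
    Summable fun k => (a k : ℂ) * circleMode k t := by
  refine Summable.of_norm_bounded (summable_geometric_two.mul_left c) fun k => ?_
  rw [norm_mul, norm_circleMode, mul_one, Complex.norm_real]
  exact ha k

/-- A lacunary series with coefficients `O(2 ^ (-k))` is `1 / 2`-Hölder. -/
theorem norm_lacunary_sub_le {a : ℕ → ℝ} {c : ℝ} (ha : ∀ k, |a k| ≤ c * (1 / 2) ^ k) {s t : ℝ}
    (hst : |t - s| ≤ 1) :
    ‖lacunary a t - lacunary a s‖ ≤ 16 * c * Real.sqrt |t - s| := by
  have hc : 0 ≤ c := by simpa using (abs_nonneg _).trans (ha 0)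
  rw [lacunary, lacunary, ← (summable_lacunary ha t).tsum_sub (summable_lacunary ha s)]
  have hsum := ((summable_lacunary ha t).sub (summable_lacunary ha s)).hasSum.tendsto_sum_nat
  refine le_of_tendsto' hsum.norm fun M => ?_
  calc _ ≤ ∑ k ∈ Finset.range M,
        c * ((1 / 2) ^ k * min 2 (2 * Real.pi * 4 ^ k * |t - s|)) := by
        refine norm_sum_le_of_le _ fun k _ => ?_
        rw [← mul_sub, norm_mul, Complex.norm_real, ← mul_assoc]
        exact mul_le_mul (ha k) (norm_circleMode_sub_le k s t) (norm_nonneg _) (by positivity)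
    _ ≤ c * (16 * Real.sqrt |t - s|) := by
        rw [← Finset.mul_sum]
        exact mul_le_mul_of_nonneg_left (sum_min_le_sqrt (abs_nonneg _) hst M) hc
    _ = _ := by ring

/-- The coefficients `2 ^ (-k) / √(k + 1)`: the `k`-th mode has Hölder constant of order
`1 / √(k + 1)`, which tends to zero, and area of order `1 / (k + 1)`, which is not summable. -/
noncomputable def loopCoeff (k : ℕ) : ℝ := (1 / 2) ^ k * (Real.sqrt (k + 1))⁻¹

theorem loopCoeff_nonneg (k : ℕ) : 0 ≤ loopCoeff k := by unfold loopCoeff; positivity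

theorem loopCoeff_le {K k : ℕ} (hk : K ≤ k) :
    loopCoeff k ≤ (Real.sqrt (K + 1))⁻¹ * (1 / 2) ^ k := by
  rw [loopCoeff, mul_comm]
  gcongr

theorem abs_loopCoeff_le (k : ℕ) : |loopCoeff k| ≤ 1 * (1 / 2) ^ k := by
  rw [abs_of_nonneg (loopCoeff_nonneg k)]
  simpa using loopCoeff_le (Nat.zero_le k)

/-- The loop is `o(√|t - s|)`, uniformly: finitely many modes are smooth, and the remaining ones
have a small Hölder constant. -/
theorem exists_norm_loop_sub_le {ε : ℝ} (hε : 0 < ε) :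
    ∃ δ : ℝ, 0 < δ ∧ ∀ s t : ℝ, |t - s| ≤ δ →
      ‖lacunary loopCoeff t - lacunary loopCoeff s‖ ≤ ε * Real.sqrt |t - s| := by
  obtain ⟨K, hK⟩ : ∃ K : ℕ, 16 * (Real.sqrt (K + 1))⁻¹ ≤ ε / 2 := by
    obtain ⟨K, hK⟩ := exists_nat_ge ((32 / ε) ^ 2)
    refine ⟨K, ?_⟩
    have h1 : 32 / ε ≤ Real.sqrt (K + 1) := Real.le_sqrt_of_sq_le (by linarith)
    have h2 : 0 < Real.sqrt (K + 1) := Real.sqrt_pos.2 (by positivity)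
    rw [← div_eq_mul_inv, div_le_iff₀ h2]
    rw [div_le_iff₀ hε] at h1
    linarith
  set M : ℝ := ∑ k ∈ Finset.range K, loopCoeff k * (2 * Real.pi * 4 ^ k) with hM
  have hM0 : 0 ≤ M := Finset.sum_nonneg fun k _ => by have := loopCoeff_nonneg k; positivity
  set b : ℕ → ℝ := fun k => if k < K then 0 else loopCoeff k with hb
  have hble : ∀ k, |b k| ≤ (Real.sqrt (K + 1))⁻¹ * (1 / 2) ^ k := fun k => by
    simp only [hb]
    split_ifs with h
    · rw [abs_zero]; positivity
    · rw [abs_of_nonneg (loopCoeff_nonneg k)]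
      exact loopCoeff_le (not_lt.1 h)
  have hsplit : ∀ t, lacunary loopCoeff t =
      (∑ k ∈ Finset.range K, (loopCoeff k : ℂ) * circleMode k t) + lacunary b t := fun t => by
    have h1 : ∑ k ∈ Finset.range K, (loopCoeff k : ℂ) * circleMode k t =
        ∑' k, if k < K then (loopCoeff k : ℂ) * circleMode k t else 0 := by
      rw [tsum_eq_sum (s := Finset.range K) fun k hk => if_neg (by simpa using hk)]
      exact Finset.sum_congr rfl fun k hk => (if_pos (by simpa using hk)).symm
    rw [h1, lacunary, lacunary, ← Summable.tsum_add _ (summable_lacunary hble t)]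
    · refine tsum_congr fun k => ?_
      simp only [hb]
      split_ifs <;> simp
    · exact summable_of_ne_finset_zero (s := Finset.range K) fun k hk => if_neg (by simpa using hk)
  refine ⟨min 1 ((ε / (2 * (M + 1))) ^ 2), by positivity, fun s t hst => ?_⟩
  have hs : Real.sqrt |t - s| ≤ ε / (2 * (M + 1)) :=
    Real.sqrt_le_iff.2 ⟨by positivity, hst.trans (min_le_right _ _)⟩
  have hs0 := Real.sqrt_nonneg |t - s|
  rw [hsplit, hsplit, add_sub_add_comm, ← Finset.sum_sub_distrib]
  have h1 : ‖∑ k ∈ Finset.range K, ((loopCoeff k : ℂ) * circleMode k t -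
      (loopCoeff k : ℂ) * circleMode k s)‖ ≤ M * |t - s| := by
    rw [hM, Finset.sum_mul]
    refine norm_sum_le_of_le _ fun k _ => ?_
    rw [← mul_sub, norm_mul, Complex.norm_real, Real.norm_of_nonneg (loopCoeff_nonneg k),
      mul_assoc]
    exact mul_le_mul_of_nonneg_left
      ((norm_circleMode_sub_le k s t).trans (min_le_right _ _)) (loopCoeff_nonneg k)
  have h2 := norm_lacunary_sub_le hble (hst.trans (min_le_left _ _))
  have h3 : M * |t - s| ≤ ε / 2 * Real.sqrt |t - s| := by
    rw [← Real.mul_self_sqrt (abs_nonneg (t - s)), Real.sqrt_mul_self hs0, ← mul_assoc]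
    refine mul_le_mul_of_nonneg_right ?_ hs0
    rw [le_div_iff₀ (by positivity)] at hs
    nlinarith
  have h4 : 16 * (Real.sqrt (K + 1))⁻¹ * Real.sqrt |t - s| ≤ ε / 2 * Real.sqrt |t - s| :=
    mul_le_mul_of_nonneg_right hK hs0
  calc _ ≤ _ := norm_add_le _ _
    _ ≤ _ := add_le_add h1 h2
    _ ≤ _ := by linarith

open ComplexConjugate in
/-- Distinct powers of a root of unity are orthogonal on the cyclic group. -/
theorem _root_.IsPrimitiveRoot.sum_conj_pow_mul_pow {n : ℕ} {ω : ℂ} (hω : IsPrimitiveRoot ω n)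
    (hnorm : conj ω * ω = 1) {p q : ℕ} (hp : p < n) (hq : q < n) :
    ∑ j ∈ Finset.range n, conj ((ω ^ p) ^ j) * (ω ^ q) ^ j = if p = q then (n : ℂ) else 0 := by
  have hnp : ∀ r : ℕ, conj (ω ^ r) * ω ^ r = 1 := fun r => by
    rw [map_pow, ← mul_pow, hnorm, one_pow]
  have e : ∀ j : ℕ, conj ((ω ^ p) ^ j) * (ω ^ q) ^ j = (conj (ω ^ p) * ω ^ q) ^ j := fun j => by
    rw [map_pow, mul_pow]
  simp only [e]
  split_ifs with h
  · subst h
    simp only [hnp, one_pow, Finset.sum_const, Finset.card_range, nsmul_eq_mul, mul_one]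
  · have hne : conj (ω ^ p) * ω ^ q ≠ 1 := fun h1 => h <| hω.pow_inj hp hq <| by
      calc ω ^ p = ω ^ p * (conj (ω ^ p) * ω ^ q) := by rw [h1, mul_one]
        _ = conj (ω ^ p) * ω ^ p * ω ^ q := by ring
        _ = ω ^ q := by rw [hnp, one_mul]
    rw [geom_sum_eq hne]
    have : (conj (ω ^ p) * ω ^ q) ^ n = 1 := by
      rw [mul_pow, ← map_pow, ← pow_mul, ← pow_mul, mul_comm p, mul_comm q, pow_mul, pow_mul,
        hω.pow_eq_one]
      simp
    rw [this, sub_self, zero_div]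

open ComplexConjugate in
/-- Twice the area of the polygon inscribed in the loop at the multiples of `4 ^ (-m)` is bounded
below by a harmonic sum. By orthogonality the modes below `4 ^ m` contribute separately, and those
above are constant on the grid. -/
theorem sum_inv_le_polygon_loop (m : ℕ) :
    4 * ∑ k ∈ Finset.range m, 1 / ((k : ℝ) + 1) ≤ ∑ j ∈ Finset.range (4 ^ m),
      (conj (lacunary loopCoeff (j / 4 ^ m) - lacunary loopCoeff 0) *
        (lacunary loopCoeff ((j + 1 : ℕ) / 4 ^ m) - lacunary loopCoeff (j / 4 ^ m))).im := by
  set n : ℕ := 4 ^ m with hn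
  have hn0 : n ≠ 0 := by positivity
  set ω : ℂ := Complex.exp (2 * Real.pi * Complex.I / n) with hω
  have hprim : IsPrimitiveRoot ω n := Complex.isPrimitiveRoot_exp n hn0
  have hnorm : conj ω * ω = 1 := by
    rw [mul_comm, Complex.mul_conj, Complex.normSq_eq_norm_sq, hprim.norm'_eq_one hn0]
    norm_num
  have hmode : ∀ k j : ℕ, circleMode k (j / 4 ^ m) = (ω ^ 4 ^ k) ^ j := fun k j => by
    rw [circleMode, ← pow_mul, hω, ← Complex.exp_nat_mul]
    congr 1
    rw [hn]
    push_cast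
    ring
  set U : ℕ → ℂ := fun j => ∑ k ∈ Finset.range m, (loopCoeff k : ℂ) * (ω ^ 4 ^ k) ^ j with hU
  have hinc : ∀ j : ℕ, lacunary loopCoeff (j / 4 ^ m) - lacunary loopCoeff 0 = U j - U 0 := by
    intro j
    have h0 : ∀ k, circleMode k 0 = 1 := fun k => by simp [circleMode]
    rw [lacunary, lacunary, ← (summable_lacunary abs_loopCoeff_le _).tsum_sub
      (summable_lacunary abs_loopCoeff_le _), tsum_eq_sum (s := Finset.range m)]
    · rw [hU, Finset.sum_sub_distrib]
      simp only [hmode, h0, pow_zero]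
    · intro k hk
      have hk' : m ≤ k := by simpa using hk
      have : ω ^ 4 ^ k = 1 := by
        obtain ⟨d, rfl⟩ := Nat.exists_eq_add_of_le hk'
        rw [pow_add, pow_mul, hprim.pow_eq_one, one_pow]
      rw [hmode, h0, this, one_pow, sub_self]
  have hUn : U n = U 0 := by
    simp only [hU]
    refine Finset.sum_congr rfl fun k _ => ?_
    rw [← pow_mul, mul_comm (4 ^ k), pow_mul, hprim.pow_eq_one, one_pow, pow_zero]
  have hcorr : ∑ j ∈ Finset.range n, conj (U j) * U (j + 1) =
      ∑ k ∈ Finset.range m, (n * loopCoeff k ^ 2 : ℝ) * ω ^ 4 ^ k := by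
    have e : ∀ j, conj (U j) * U (j + 1) = ∑ k ∈ Finset.range m, ∑ l ∈ Finset.range m,
        (loopCoeff k : ℂ) * loopCoeff l * ω ^ 4 ^ l *
          (conj ((ω ^ 4 ^ k) ^ j) * (ω ^ 4 ^ l) ^ j) := fun j => by
      simp only [hU]
      rw [map_sum, Finset.sum_mul_sum]
      refine Finset.sum_congr rfl fun k _ => Finset.sum_congr rfl fun l _ => ?_
      rw [map_mul, Complex.conj_ofReal, pow_succ]
      ring
    simp only [e]
    rw [Finset.sum_comm]
    refine Finset.sum_congr rfl fun k hk => ?_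
    have hlt : ∀ l ∈ Finset.range m, 4 ^ l < n := fun l hl =>
      Nat.pow_lt_pow_right (by norm_num) (Finset.mem_range.1 hl)
    rw [Finset.sum_comm, Finset.sum_eq_single_of_mem k hk]
    · rw [← Finset.mul_sum, hprim.sum_conj_pow_mul_pow hnorm (hlt k hk) (hlt k hk), if_pos rfl]
      push_cast
      ring
    · intro l hl hlk
      rw [← Finset.mul_sum, hprim.sum_conj_pow_mul_pow hnorm (hlt k hk) (hlt l hl), if_neg,
        mul_zero]
      exact fun h => hlk (Nat.pow_right_injective (by norm_num) h).symm
  have htotal : ∑ j ∈ Finset.range n,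
      (conj (lacunary loopCoeff (j / 4 ^ m) - lacunary loopCoeff 0) *
        (lacunary loopCoeff ((j + 1 : ℕ) / 4 ^ m) - lacunary loopCoeff (j / 4 ^ m))).im =
      (∑ j ∈ Finset.range n, conj (U j) * U (j + 1)).im := by
    have e : ∀ j : ℕ, (conj (lacunary loopCoeff (j / 4 ^ m) - lacunary loopCoeff 0) *
        (lacunary loopCoeff ((j + 1 : ℕ) / 4 ^ m) - lacunary loopCoeff (j / 4 ^ m))).im =
        (conj (U j) * U (j + 1)).im - ((conj (U 0) * U (j + 1)).im - (conj (U 0) * U j).im) := by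
      intro j
      have h1 : lacunary loopCoeff ((j + 1 : ℕ) / 4 ^ m) - lacunary loopCoeff (j / 4 ^ m) =
          U (j + 1) - U j := by
        rw [← sub_sub_sub_cancel_right _ _ (lacunary loopCoeff 0), hinc, hinc]; ring
      rw [hinc, h1]
      simp only [map_sub, Complex.mul_im, Complex.sub_re, Complex.sub_im, Complex.conj_re,
        Complex.conj_im]
      ring
    rw [Finset.sum_congr rfl fun j _ => e j, Finset.sum_sub_distrib,
      Finset.sum_range_sub (fun j => (conj (U 0) * U j).im), hUn, sub_self, sub_zero,
      Complex.im_sum]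
  rw [htotal, hcorr, Complex.im_sum, Finset.mul_sum]
  refine Finset.sum_le_sum fun k hk => ?_
  obtain ⟨l, rfl⟩ := Nat.exists_eq_add_of_lt (Finset.mem_range.1 hk)
  rw [Complex.im_ofReal_mul]
  have him : (ω ^ 4 ^ k).im = Real.sin (2 * Real.pi / 4 ^ (l + 1)) := by
    have h1 := hmode k 1
    rw [pow_one] at h1
    rw [← h1, circleMode, Complex.exp_ofReal_mul_I_im]
    congr 1
    rw [add_assoc, pow_add]
    push_cast
    field_simp
  have hpow : (4 : ℝ) ≤ 4 ^ (l + 1) := by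
    rw [pow_succ]; nlinarith [one_le_pow₀ (M₀ := ℝ) (a := 4) (n := l) (by norm_num)]
  have hsin : 4 / 4 ^ (l + 1) ≤ Real.sin (2 * Real.pi / 4 ^ (l + 1)) := by
    have hle : 2 * Real.pi / 4 ^ (l + 1) ≤ Real.pi / 2 := by
      rw [div_le_div_iff₀ (by positivity) two_pos]
      nlinarith [Real.pi_pos]
    have := Real.mul_le_sin (by positivity) hle
    refine le_trans (le_of_eq ?_) this
    field_simp
    ring
  have hcoef : (n : ℝ) * loopCoeff k ^ 2 = 4 ^ (l + 1) * (1 / ((k : ℝ) + 1)) := by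
    rw [hn, loopCoeff, mul_pow, inv_pow, Real.sq_sqrt (by positivity), add_assoc, pow_add]
    have : ((1 / 2 : ℝ) ^ k) ^ 2 * 4 ^ k = 1 := by
      rw [← pow_mul, mul_comm k, pow_mul, ← mul_pow]; norm_num
    push_cast
    linear_combination (4 ^ (l + 1) * ((k : ℝ) + 1)⁻¹) * this
  rw [him, hcoef]
  calc 4 * (1 / ((k : ℝ) + 1)) = 4 ^ (l + 1) * (1 / ((k : ℝ) + 1)) * (4 / 4 ^ (l + 1)) := by
        field_simp
    _ ≤ _ := mul_le_mul_of_nonneg_left hsin (by positivity)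

end RoughArea

/-! ### Density of the complement -/

namespace RoughArea

variable {T : ℝ} {V : Type*} [NormedAddCommGroup V] [NormedSpace ℝ V] {N : TensorNorm V}

/-- The partition of `[0, T]` into `n` intervals of equal length. -/
noncomputable def uniformPartition (hT : 0 < T) {n : ℕ} (hn : 0 < n) : Partition T 0 T where
  n := n
  pts j := ⟨T * (j / n), by
    have hj : ((j : ℕ) : ℝ) ≤ n := by exact_mod_cast Nat.lt_succ_iff.1 j.2
    have hn' : (0 : ℝ) < n := by exact_mod_cast hn
    exact ⟨by positivity, mul_le_of_le_one_right hT.le ((div_le_one hn').2 hj)⟩⟩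
  strictMono i j hij := by
    have hn' : (0 : ℝ) < n := by exact_mod_cast hn
    have hij' : ((i : ℕ) : ℝ) < (j : ℕ) := by exact_mod_cast hij
    change T * ((i : ℕ) / n : ℝ) < T * ((j : ℕ) / n)
    gcongr
  first := by simp
  last := by
    have hn' : (n : ℝ) ≠ 0 := by exact_mod_cast hn.ne'
    simp [hn']

theorem uniformPartition_pts (hT : 0 < T) {n : ℕ} (hn : 0 < n) (j : Fin (n + 1)) :
    (((uniformPartition hT hn).pts j : Time T) : ℝ) = T * (j / n) := rfl

theorem mesh_uniformPartition_le (hT : 0 < T) {n : ℕ} (hn : 0 < n) {δ : ℝ≥0}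
    (h : T / n ≤ δ) : (uniformPartition hT hn).mesh ≤ δ := by
  refine Finset.sup_le fun j _ => ?_
  rw [nndist_le_iff ((uniformPartition hT hn).seg j).2]
  refine le_trans (le_of_eq ?_) h
  change T * (((j : ℕ) + 1 : ℕ) / n) - T * ((j : ℕ) / n) = T / n
  push_cast
  ring

theorem bracket_smul_add_smul (v w : V) (a b : ℂ) :
    bracket N (a.re • v + a.im • w) (b.re • v + b.im • w) =
      (starRingEnd ℂ a * b).im • bracket N v w := by
  simp only [← bracketCLM_apply, map_add, map_smul, _root_.add_apply, _root_.smul_apply]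
  simp only [bracketCLM_apply, bracket_self, bracket_swap N v w, Complex.mul_im, Complex.conj_re,
    Complex.conj_im]
  module

/-- A path of vanishing `2`-variation, `1 / 2`-Hölder, with unbounded polygonal areas along
partitions of arbitrarily small mesh: the lacunary loop, in a two-dimensional subspace. -/
theorem exists_path_unbounded_polygonArea (hV : 2 ≤ Module.rank ℝ V) (N : TensorNorm V)
    (hT : 0 < T) :
    ∃ ζ ∈ vanishingPaths T V 2,
      (∃ C : ℝ, 0 ≤ C ∧ ∀ q : Triangle T, ‖incr ζ q‖ ^ 2 ≤ C * (q.1.2 - q.1.1)) ∧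
      ∀ (M : ℝ) (δ : ℝ≥0), 0 < δ → ∃ D : Partition T 0 T, D.mesh ≤ δ ∧ M < ‖polygonArea N ζ D‖ := by
  obtain ⟨f, hf⟩ := Module.le_rank_iff.1
    (show ((2 : ℕ) : Cardinal) ≤ Module.rank ℝ V by exact_mod_cast hV)
  obtain ⟨v, w, hvw⟩ : ∃ v w : V, LinearIndependent ℝ ![v, w] :=
    ⟨f 0, f 1, by convert hf using 1; ext i; fin_cases i <;> rfl⟩
  have hne := bracket_ne_zero N hvw
  set Z := lacunary loopCoeff with hZ
  set L : ℝ := ‖v‖ + ‖w‖ with hL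
  have hL0 : 0 ≤ L := by positivity
  have hJ : ∀ z : ℂ, ‖z.re • v + z.im • w‖ ≤ L * ‖z‖ := fun z => by
    refine (norm_add_le _ _).trans ?_
    rw [norm_smul, norm_smul, hL, add_mul, mul_comm ‖v‖, mul_comm ‖w‖]
    gcongr
    · exact Complex.abs_re_le_norm z
    · exact Complex.abs_im_le_norm z
  have hZc : Continuous Z := by
    refine continuous_tsum (u := fun k : ℕ => 1 * (1 / 2 : ℝ) ^ k)
      (fun k => by unfold circleMode; fun_prop) (summable_geometric_two.mul_left 1)
      fun k t => ?_
    rw [norm_mul, norm_circleMode, mul_one, Complex.norm_real]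
    exact abs_loopCoeff_le k
  let ζ : C(Time T, V) := ⟨fun t => (Z (t / T)).re • v + (Z (t / T)).im • w, by
    have h1 : Continuous fun t : Time T => Z (t / T) := hZc.comp (by fun_prop)
    exact ((Complex.continuous_re.comp h1).smul continuous_const).add
      ((Complex.continuous_im.comp h1).smul continuous_const)⟩
  have hζ : ∀ s t : Time T, ζ t - ζ s =
      (Z (t / T) - Z (s / T)).re • v + (Z (t / T) - Z (s / T)).im • w := fun s t => by
    simp only [ζ, ContinuousMap.coe_mk, Complex.sub_re, Complex.sub_im]
    module
  have habs : ∀ q : Triangle T, |(q.1.2 : ℝ) / T - q.1.1 / T| = (q.1.2 - q.1.1) / T := fun q => by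
    rw [← sub_div, abs_of_nonneg]
    exact div_nonneg (sub_nonneg.2 (Subtype.coe_le_coe.2 q.2)) hT.le
  have hsq : ∀ (q : Triangle T) (c : ℝ),
      ‖Z (q.1.2 / T) - Z (q.1.1 / T)‖ ≤ c * Real.sqrt ((q.1.2 - q.1.1) / T) →
      ‖incr ζ q‖ ^ 2 ≤ (L * c) ^ 2 / T * (q.1.2 - q.1.1) := fun q c hq => by
    have h0 : (0 : ℝ) ≤ (q.1.2 - q.1.1) / T :=
      div_nonneg (sub_nonneg.2 (Subtype.coe_le_coe.2 q.2)) hT.le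
    have h1 : ‖incr ζ q‖ ≤ L * (c * Real.sqrt ((q.1.2 - q.1.1) / T)) := by
      rw [incr, hζ]
      exact (hJ _).trans (mul_le_mul_of_nonneg_left hq hL0)
    calc _ ≤ (L * (c * Real.sqrt ((q.1.2 - q.1.1) / T))) ^ 2 := by gcongr
      _ = (L * c) ^ 2 * Real.sqrt ((q.1.2 - q.1.1) / T) ^ 2 := by ring
      _ = _ := by rw [Real.sq_sqrt h0]; ring
  refine ⟨ζ, ?_, ⟨(L * (16 * 1)) ^ 2 / T, by positivity, fun q => hsq q _ ?_⟩, fun M δ hδ => ?_⟩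
  · refine vanishingPVar_of_little_holder two_pos hT fun ε hε => ?_
    -- `c` is chosen so that `(L * c) ^ 2 / T ≤ ε`
    set c : ℝ := Real.sqrt (ε * T) / (L + 1) with hc
    have hc0 : 0 < c := div_pos (Real.sqrt_pos.2 (by positivity)) (by positivity)
    have hLc : (L * c) ^ 2 / T ≤ ε := by
      have h1 : L * c ≤ Real.sqrt (ε * T) := by
        rw [hc, mul_div_assoc', div_le_iff₀ (by positivity), mul_comm]
        exact mul_le_mul_of_nonneg_left (by linarith) (Real.sqrt_nonneg _)
      rw [div_le_iff₀ hT, ← Real.sq_sqrt (show 0 ≤ ε * T by positivity)]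
      gcongr
    obtain ⟨δ, hδ, H⟩ := exists_norm_loop_sub_le hc0
    refine ⟨δ * T, by positivity, fun q hq => ?_⟩
    have h0 : (0 : ℝ) ≤ q.1.2 - q.1.1 := sub_nonneg.2 (Subtype.coe_le_coe.2 q.2)
    have := H (q.1.1 / T) (q.1.2 / T) (by rw [habs, div_le_iff₀ hT]; exact hq)
    rw [habs] at this
    rw [Real.rpow_two]
    exact (hsq q c this).trans (mul_le_mul_of_nonneg_right hLc h0)
  · have := norm_lacunary_sub_le abs_loopCoeff_le (s := q.1.1 / T) (t := q.1.2 / T) (by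
      rw [habs, div_le_one hT]
      linarith [q.1.1.2.1, q.1.2.2.2])
    rwa [habs] at this
  · have hb : 0 < ‖bracket N v w‖ := norm_pos_iff.2 hne
    have hev1 : ∀ᶠ m : ℕ in atTop,
        M / ‖bracket N v w‖ < 4 * ∑ k ∈ Finset.range m, 1 / ((k : ℝ) + 1) :=
      (Real.tendsto_sum_range_one_div_nat_succ_atTop.const_mul_atTop
        (by norm_num : (0 : ℝ) < 4)).eventually_gt_atTop _
    have hev2 : ∀ᶠ m : ℕ in atTop, T / ((4 ^ m : ℕ) : ℝ) ≤ δ := by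
      have h4 : Tendsto (fun m : ℕ => T / ((4 ^ m : ℕ) : ℝ)) atTop (𝓝 0) := by
        refine Tendsto.div_atTop tendsto_const_nhds ?_
        push_cast
        exact tendsto_pow_atTop_atTop_of_one_lt (by norm_num)
      exact h4.eventually_le_const hδ
    obtain ⟨m, h1, h2⟩ := (hev1.and hev2).exists
    have hpos : 0 < 4 ^ m := by positivity
    refine ⟨uniformPartition hT hpos, mesh_uniformPartition_le hT hpos h2, ?_⟩
    have hpt : ∀ j : Fin (4 ^ m + 1),
        (((uniformPartition hT hpos).pts j : Time T) : ℝ) / T = (j : ℕ) / 4 ^ m := fun j => by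
      rw [uniformPartition_pts]
      push_cast
      field_simp
    have hpoly : polygonArea N ζ (uniformPartition hT hpos) =
        (∑ j ∈ Finset.range (4 ^ m), (starRingEnd ℂ (Z (j / 4 ^ m) - Z 0) *
          (Z ((j + 1 : ℕ) / 4 ^ m) - Z (j / 4 ^ m))).im) • bracket N v w := by
      rw [Finset.sum_smul, ← Fin.sum_univ_eq_sum_range (fun j : ℕ =>
        (starRingEnd ℂ (Z (j / 4 ^ m) - Z 0) *
          (Z ((j + 1 : ℕ) / 4 ^ m) - Z (j / 4 ^ m))).im • bracket N v w)]
      refine Finset.sum_congr rfl fun j _ => ?_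
      rw [hζ, hζ, bracket_smul_add_smul]
      have e1 := hpt (Fin.castSucc j)
      have e2 := hpt (Fin.succ j)
      have e3 := hpt 0
      simp only [Fin.val_zero, Nat.cast_zero, zero_div] at e3
      erw [e1, e2, e3]
      rfl
    rw [hpoly, norm_smul]
    rw [div_lt_iff₀ hb] at h1
    refine h1.trans_le (mul_le_mul_of_nonneg_right ?_ hb.le)
    exact (sum_inv_le_polygon_loop m).trans (le_abs_self _)

/-- Polygonal area is a quadratic form in the path. -/
theorem polygonArea_parallelogram (γ ζ : C(Time T, V)) (κ : ℝ) (D : Partition T 0 T) :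
    polygonArea N (γ + κ • ζ) D + polygonArea N (γ - κ • ζ) D =
      (2 : ℝ) • polygonArea N γ D + (2 * κ ^ 2) • polygonArea N ζ D := by
  simp only [polygonArea, Finset.smul_sum, ← Finset.sum_add_distrib]
  refine Finset.sum_congr rfl fun j _ => ?_
  simp only [ContinuousMap.add_apply, ContinuousMap.sub_apply, ContinuousMap.smul_apply,
    ← bracketCLM_apply, map_add, map_sub, map_smul, _root_.add_apply, _root_.sub_apply,
    _root_.smul_apply]
  module

theorem smul_mem_vanishingPaths {γ : C(Time T, V)} (hγ : γ ∈ vanishingPaths T V 2) (κ : ℝ) :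
    κ • γ ∈ vanishingPaths T V 2 := by
  rw [vanishingPaths_two_iff] at *
  intro ε hε
  obtain ⟨δ, hδ, H⟩ := hγ (ε / (κ ^ 2 + 1)) (by positivity)
  refine ⟨δ, hδ, fun D hD => ?_⟩
  have h1 := H D hD
  rw [le_div_iff₀ (by positivity)] at h1
  simp only [ContinuousMap.smul_apply, ← smul_sub, norm_smul, mul_pow, Real.norm_eq_abs, sq_abs]
  rw [← Finset.mul_sum]
  have h2 : 0 ≤ ∑ j : Fin D.n, ‖γ (D.pts j.succ) - γ (D.pts j.castSucc)‖ ^ 2 :=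
    Finset.sum_nonneg fun _ _ => by positivity
  linarith

theorem pVar_smul_le {ζ : C(Time T, V)} {C c κ : ℝ}
    (hζ : ∀ q : Triangle T, ‖incr ζ q‖ ^ 2 ≤ C * (q.1.2 - q.1.1)) (hc : 0 ≤ c)
    (hκ : κ ^ 2 * C * T ≤ c ^ 2) : pVar 2 (incr (κ • ζ)) ≤ ENNReal.ofReal c := by
  refine pVar_le_of_holder two_pos (C := κ ^ 2 * C) (fun q => ?_) hc (by rwa [Real.rpow_two])
  have e : incr (κ • ζ) q = κ • incr ζ q := by simp [incr, smul_sub]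
  rw [Real.rpow_two, e, norm_smul, mul_pow, Real.norm_eq_abs, sq_abs, mul_assoc]
  exact mul_le_mul_of_nonneg_left (hζ q) (sq_nonneg κ)

theorem denseInPVar_compl_G2 (hV : 2 ≤ Module.rank ℝ V) (N : TensorNorm V) (hT : 0 < T) :
    DenseInPVar 2 (vanishingPaths T V 2 \ G2 T N) (vanishingPaths T V 2) := by
  refine ⟨fun _ h => h.1, fun γ hγ ε hε => ?_⟩
  obtain ⟨ζ, hζ, ⟨C, hC, hHol⟩, hunb⟩ := exists_path_unbounded_polygonArea hV N hT
  set κ : ℝ := ε / 2 / Real.sqrt (C * T + 1) with hκ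
  have hpos : 0 < C * T + 1 := by positivity
  have hκ0 : 0 < κ := div_pos (by positivity) (Real.sqrt_pos.2 hpos)
  have hκ2 : κ ^ 2 * C * T ≤ (ε / 2) ^ 2 := by
    rw [hκ, div_pow, Real.sq_sqrt hpos.le, mul_assoc, div_mul_eq_mul_div, div_le_iff₀ hpos]
    exact mul_le_mul_of_nonneg_left (by linarith) (by positivity)
  have hlt : ENNReal.ofReal (ε / 2) < ENNReal.ofReal ε :=
    (ENNReal.ofReal_lt_ofReal_iff hε).2 (by linarith)
  have hsub : γ - κ • ζ = γ + (-κ) • ζ := by rw [neg_smul, sub_eq_add_neg]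
  by_contra! hcon
  -- otherwise all three of `γ`, `γ + κ ζ`, `γ - κ ζ` could be enhanced
  have h0 : γ ∈ G2 T N := by
    by_contra h
    have := hcon γ ⟨hγ, h⟩
    rw [sub_self] at this
    have hz : pVar 2 (incr (0 : C(Time T, V))) ≤ ENNReal.ofReal 0 := by
      rw [pVar_le_ofReal_iff two_pos le_rfl]; simp [incr]
    exact absurd (this.trans hz) (by simpa using hε)
  have h1 : γ + κ • ζ ∈ G2 T N := by
    by_contra h
    have := hcon _ ⟨add_mem_vanishingPaths hγ (smul_mem_vanishingPaths hζ κ), h⟩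
    rw [sub_add_cancel_left, ← neg_smul] at this
    exact absurd this (not_le.2 ((pVar_smul_le hHol (by positivity) (by rwa [neg_sq])).trans_lt hlt))
  have h2 : γ - κ • ζ ∈ G2 T N := by
    by_contra h
    have := hcon _ ⟨hsub ▸ add_mem_vanishingPaths hγ (smul_mem_vanishingPaths hζ (-κ)), h⟩
    rw [sub_sub_cancel] at this
    exact absurd this (not_le.2 ((pVar_smul_le hHol (by positivity) hκ2).trans_lt hlt))
  obtain ⟨C₀, δ₀, hδ₀, H₀⟩ := exists_norm_polygonArea_le hT h0
  obtain ⟨C₁, δ₁, hδ₁, H₁⟩ := exists_norm_polygonArea_le hT h1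
  obtain ⟨C₂, δ₂, hδ₂, H₂⟩ := exists_norm_polygonArea_le hT h2
  obtain ⟨D, hD, hM⟩ := hunb ((C₁ + C₂ + 2 * C₀) / (2 * κ ^ 2)) (min δ₀ (min δ₁ δ₂))
    (lt_min hδ₀ (lt_min hδ₁ hδ₂))
  have b₀ := H₀ D (hD.trans (min_le_left _ _))
  have b₁ := H₁ D (hD.trans ((min_le_right _ _).trans (min_le_left _ _)))
  have b₂ := H₂ D (hD.trans ((min_le_right _ _).trans (min_le_right _ _)))
  have key : (2 * κ ^ 2) • polygonArea N ζ D = polygonArea N (γ + κ • ζ) D +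
      polygonArea N (γ - κ • ζ) D - (2 : ℝ) • polygonArea N γ D := by
    rw [eq_sub_iff_add_eq, add_comm]
    exact (polygonArea_parallelogram γ ζ κ D).symm
  have hnorm := congrArg norm key
  rw [norm_smul, Real.norm_of_nonneg (by positivity)] at hnorm
  have htri := norm_sub_le (polygonArea N (γ + κ • ζ) D + polygonArea N (γ - κ • ζ) D)
    ((2 : ℝ) • polygonArea N γ D)
  rw [norm_smul, Real.norm_of_nonneg two_pos.le] at htri
  have htri' := norm_add_le (polygonArea N (γ + κ • ζ) D) (polygonArea N (γ - κ • ζ) D)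
  rw [div_lt_iff₀ (by positivity)] at hM
  linarith

end RoughArea

theorem mainTheorem8 {V : Type*} [NormedAddCommGroup V] [NormedSpace ℝ V] [CompleteSpace V]
    (hV : 2 ≤ Module.rank ℝ V) (N : RoughArea.TensorNorm V) (T : ℝ) (hT : 0 < T) :
    RoughArea.DenseInPVar 2 (RoughArea.G2 T N) (RoughArea.vanishingPaths T V 2) ∧
      RoughArea.DenseInPVar 2 (RoughArea.vanishingPaths T V 2 \ RoughArea.G2 T N)
        (RoughArea.vanishingPaths T V 2) := by
  refine ⟨⟨fun _ h => h.1, fun γ hγ ε hε => ?_⟩, RoughArea.denseInPVar_compl_G2 hV N hT⟩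
  obtain ⟨η, hη, h⟩ := RoughArea.exists_mem_G2_near N hT hγ (half_pos hε)
  exact ⟨η, hη, h.trans_lt ((ENNReal.ofReal_lt_ofReal_iff hε).2 (half_lt_self hε))⟩
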